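/- **Theorem 2 (General upper bound for Tucker rank $\boldsymbol r$ tensors).** There is an absolute constant $C>0$ such that the following holds. Let $n\ge 1$ and let $\mathcal W=\boldsymbol w_1\circ\cdots\circ\boldsymbol w_n\in\mathbb R^{d_1\times\cdots\times d_n}$ be a rank-one tensor, $\mathcal W_{i_1\cdots i_n}=\prod_{k}\boldsymbol w_k(i_k)$, with strictly positive entries. Fix $\Omega\subseteq[d_1]\times\cdots\times[d_n]$, let $\boldsymbol 1_\Omega$ be the tensor with entries $1$ on $\Omega$ and $0$ elsewhere, and for a tensor $\mathcal X$ let $\mathcal X_\Omega$ agree with $\mathcal X$ on $\Omega$ and vanish elsewhere. Write $\mathcal X_{(k)}\in\mathbb R^{d_k\times\prod_{j\ne k}d_j}$ for the mode-$k$ unfolding of $\mathcal X$, $\mathcal X\times_k A$ for the mode-$k$ product, so that $(\mathcal X\times_kA)_{(k)}=A\mathcal X_{(k)}$, $\odot$ for the entrywise product, $\mathcal W^{(\alpha)}$ for the entrywise power, $\|\cdot\|_F$ for the Frobenius norm, $\|\cdot\|_2$ for the spectral norm of a matrix, and $\|\mathcal X\|_\infty$ for the largest absolute value of an entry of $\mathcal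 X$. Let $\mathcal T\in\mathbb R^{d_1\times\cdots\times d_n}$ have Tucker rank $(r_1,\dots,r_n)$, i.e. $r_k=\operatorname{rank}\mathcal T_{(k)}$ for all $k$. Let $\mathcal Z$ be a random tensor of the same size with independent entries $\mathcal Z_{i_1\cdots i_n}\sim\mathcal N(0,\sigma^2)$, $\sigma\ge0$, and let $\mathcal Y_\Omega=\mathcal T_\Omega+\mathcal Z_\Omega$. For each $k$ let $\widehat A_k$ be a minimizer of $\|A-(\mathcal W^{(-1/2)}\odot\mathcal Y_\Omega)_{(k)}\|_2$ over the matrices $A$ of rank at most $r_k$, and let $\widehat U_k\in\mathbb R^{d_k\times r_k}$ be a matrix of left singular vectors of $\widehat A_k$, that is, $\widehat A_k=\widehat U_k\,\mathrm{diag}(s)\,V^{T}$ with $s\ge0$, where $\widehat U_k$ and $V$ have $r_k$ orthonormal columns each (for instance, $\widehat U_k$ may consist of the top $r_k$ left singular vectors of $(\mathcal W^{(-1/2)}\odot\mathcal Y_\Omega)_{(k)}$). Set $$\widehat{\mathcal T}=\mathcal W^{(-1/2)}\odot\Big((\mathcal W^{(-1/2)}\odot\mathcal Y_\Omega)\times_1\widehat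 U_1\widehat U_1^T\times_2\cdots\times_n\widehat U_n\widehat U_n^T\Big).$$ Then with probability at least $1-\sum_{k=1}^n\frac1{d_k+\prod_{j\ne k}d_j}$ over the choice of $\mathcal Z$, simultaneously for all such choices of $\widehat U_1,\dots,\widehat U_n$, $$\|\mathcal W^{(1/2)}\odot(\mathcal T-\widehat{\mathcal T})\|_F\le C\left[\Big(\sum_{k=1}^n\sqrt{r_k\log\big(d_k+\textstyle\prod_{j\ne k}d_j\big)}\,\mu_k\Big)\sigma+\Big(\sum_{k=1}^n r_k\big\|(\mathcal W^{(-1/2)}\odot\boldsymbol 1_\Omega-\mathcal W^{(1/2)})_{(k)}\big\|_2\Big)\|\mathcal T\|_\infty\right],$$ where $\mu_k\ge0$ and $$\mu_k^2=\max_{i_1,\dots,i_n}\max\Big\{\sum_{i_1,\dots,i_{k-1},i_{k+1},\dots,i_n}\frac{(\boldsymbol 1_\Omega)_{i_1\cdots i_n}}{\mathcal W_{i_1\cdots i_n}},\ \sum_{i_k}\frac{(\boldsymbol 1_\Omega)_{i_1\cdots i_n}}{\mathcal W_{i_1\cdots i_n}}\Big\}.$$ -/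

import Mathlib

open MeasureTheory ProbabilityTheory
open scoped NNReal

namespace TensorCompletion

/-- Multi-indices of real tensors of order `n` and size `d 0 × ⋯ × d (n-1)`. -/
abbrev Index {n : ℕ} (d : Fin n → ℕ) : Type := ∀ k : Fin n, Fin (d k)

/-- Real tensors of order `n` and size `d 0 × ⋯ × d (n-1)`. -/
abbrev Tensor {n : ℕ} (d : Fin n → ℕ) : Type := Index d → ℝ

/-- Multi-indices of all modes except mode `k`. -/
abbrev CoIndex {n : ℕ} (d : Fin n → ℕ) (k : Fin n) : Type :=
  ∀ j : {j : Fin n // j ≠ k}, Fin (d j)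

section Matrices

open scoped Matrix.Norms.L2Operator

/-- The spectral norm of a real matrix (its largest singular value), i.e. the operator norm with
respect to the Euclidean norms. -/
noncomputable def specNorm {a b : Type} [Fintype a] [Fintype b] [DecidableEq b]
    (M : Matrix a b ℝ) : ℝ := ‖M‖

end Matrices

/-- `A` minimises the spectral distance to `M` among the matrices of rank at most `r`. -/
def IsBestRankApprox {a b : Type} [Fintype a] [Fintype b] [DecidableEq b]
    (M : Matrix a b ℝ) (r : ℕ) (A : Matrix a b ℝ) : Prop :=
  A.rank ≤ r ∧ ∀ B : Matrix a b ℝ, B.rank ≤ r → specNorm (A - M) ≤ specNorm (B - M)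

/-- `U` is a left singular vector matrix of `A`, with `r` columns: there is a singular value
decomposition `A = U * diag(s) * Vᵀ`, where `U` and `V` have `r` orthonormal columns each and
`s ≥ 0` (some of the `s i` vanish if `A` has rank less than `r`). -/
def IsLeftSingularMatrix {a b : Type} [Fintype a] [Fintype b] {r : ℕ}
    (A : Matrix a b ℝ) (U : Matrix a (Fin r) ℝ) : Prop :=
  ∃ (s : Fin r → ℝ) (V : Matrix b (Fin r) ℝ),
    U.transpose * U = 1 ∧ V.transpose * V = 1 ∧ (∀ i, 0 ≤ s i) ∧
      A = U * Matrix.diagonal s * V.transpose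

section Tensors

variable {n : ℕ} {d : Fin n → ℕ}

/-- The outer product `w 0 ∘ ⋯ ∘ w (n-1)` of vectors. -/
def outer (w : ∀ k : Fin n, Fin (d k) → ℝ) : Tensor d := fun i => ∏ k, w k (i k)

/-- The entrywise product of tensors. -/
def hadamard (S T : Tensor d) : Tensor d := fun i => S i * T i

/-- The entrywise power `T^(α)`. -/
noncomputable def hpow (T : Tensor d) (α : ℝ) : Tensor d := fun i => T i ^ α

/-- The tensor with entries `1` on `Ω` and `0` elsewhere. -/
def indicator (Ω : Finset (Index d)) : Tensor d := fun i => if i ∈ Ω then 1 else 0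

/-- The tensor `T_Ω`, which agrees with `T` on `Ω` and vanishes elsewhere. -/
def restrict (Ω : Finset (Index d)) (T : Tensor d) : Tensor d :=
  fun i => if i ∈ Ω then T i else 0

/-- The maximum of the absolute values of the entries. -/
noncomputable def supNorm (T : Tensor d) : ℝ := ⨆ i, |T i|

/-- The Frobenius norm. -/
noncomputable def frobNorm (T : Tensor d) : ℝ := Real.sqrt (∑ i, T i ^ 2)

/-- The mode-`k` unfolding: the columns are the vectors obtained from `T` by fixing all indices
but the `k`-th. -/
def unfold (T : Tensor d) (k : Fin n) : Matrix (Fin (d k)) (CoIndex d k) ℝ :=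
  Matrix.of fun a b => T ((Equiv.piSplitAt k (fun j => Fin (d j))).symm (a, b))

/-- `T` has Tucker rank `r`: the mode-`k` unfolding has rank `r k` for every `k`. -/
def HasTuckerRank (T : Tensor d) (r : Fin n → ℕ) : Prop := ∀ k, (unfold T k).rank = r k

/-- The mode-`k` product `T ×_k A` with a square matrix `A`. -/
def modeProd (T : Tensor d) (k : Fin n) (A : Matrix (Fin (d k)) (Fin (d k)) ℝ) : Tensor d :=
  fun i => ∑ a : Fin (d k), T (Function.update i k a) * A (i k) a

/-- The iterated product `T ×_1 A_1 ×_2 ⋯ ×_n A_n`, from left to right. -/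
def multiModeProd (T : Tensor d) (A : ∀ k : Fin n, Matrix (Fin (d k)) (Fin (d k)) ℝ) : Tensor d :=
  (List.finRange n).foldl (fun X k => modeProd X k (A k)) T

/-- `μ_k²`: the maximum, over all multi-indices `i`, of the sum of `1_Ω / W` over the multi-indices
with the same `k`-th index as `i` and of the sum of `1_Ω / W` over the `k`-th index with the other
indices as in `i`. -/
noncomputable def muSq (W : Tensor d) (Ω : Finset (Index d)) (k : Fin n) : ℝ :=
  ⨆ i : Index d, max (∑ j : Index d with j k = i k, indicator Ω j / W j)
    (∑ a : Fin (d k),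
      indicator Ω (Function.update i k a) / W (Function.update i k a))

/-- `μ_k ≥ 0`. -/
noncomputable def mu (W : Tensor d) (Ω : Finset (Index d)) (k : Fin n) : ℝ :=
  Real.sqrt (muSq W Ω k)

/-- The weighted data tensor `W^(-1/2) ∘ Y_Ω`, where `Y_Ω = T_Ω + Z_Ω`. -/
noncomputable def weightedData (W : Tensor d) (Ω : Finset (Index d)) (T Z : Tensor d) : Tensor d :=
  hadamard (hpow W (-1 / 2)) (restrict Ω T + restrict Ω Z)

/-- `U k` (`k = 1, …, n`) are factor matrices of the HOSVD of `X` with target ranks `r k`: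
`U k` is a left singular vector matrix, with `r k` columns, of a best approximation in spectral norm
of rank at most `r k` of the mode-`k` unfolding of `X`. -/
def IsHOSVDFactors (X : Tensor d) (r : Fin n → ℕ)
    (U : ∀ k : Fin n, Matrix (Fin (d k)) (Fin (r k)) ℝ) : Prop :=
  ∀ k, ∃ A : Matrix (Fin (d k)) (CoIndex d k) ℝ,
    IsBestRankApprox (unfold X k) (r k) A ∧ IsLeftSingularMatrix A (U k)

/-- The weighted HOSVD estimator
`W^(-1/2) ∘ ((W^(-1/2) ∘ Y_Ω) ×_1 U_1 U_1ᵀ ×_2 ⋯ ×_n U_n U_nᵀ)`. -/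
noncomputable def wHOSVD (W : Tensor d) (Ω : Finset (Index d)) (T Z : Tensor d) {r : Fin n → ℕ}
    (U : ∀ k : Fin n, Matrix (Fin (d k)) (Fin (r k)) ℝ) : Tensor d :=
  hadamard (hpow W (-1 / 2))
    (multiModeProd (weightedData W Ω T Z) (fun k => U k * (U k).transpose))

end Tensors

/-- `d_k + ∏_{j ≠ k} d_j`, the sum of the two dimensions of the mode-`k` unfolding. -/
noncomputable def dimSum {n : ℕ} (d : Fin n → ℕ) (k : Fin n) : ℝ :=
  (d k : ℝ) + ∏ j ∈ Finset.univ.erase k, (d j : ℝ)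

end TensorCompletion

/-! Put X = W^(1/2) ⊙ T and let Y be the weighted data. Since W is an outer product, the weight acts
on each unfolding by diagonal matrices on the left and right, so X_(k) still has rank at most r_k.
The weighted error is X minus the HOSVD projection of Y, and everything reduces to the spectral
norms of (X - Y)_(k).

Deterministic part (`frobNorm_sub_hosvd_le`): write P for the product of the projections P_k = U_k
U_kᵀ and split X - P Y = (X - P X) + P (X - Y). The first term telescopes over the modes into
residuals (1 - P_k) X_(k), of rank at most r_k and spectral norm at most 2‖(X - Y)_(k)‖. The second
has rank at most r_k in one mode. Passing from spectral to Frobenius norm costs √r_k, and the total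
is 3 ∑ √r_k ‖(X - Y)_(k)‖.

Sampling error: up to sign, X - Y is M ⊙ T plus weighted noise, with M = W^(-1/2) ⊙ 1_Ω - W^(1/2). A
matrix of rank r with entries bounded by c acts as a Schur multiplier of norm at most √r c
(`specNorm_hadamard_le`), by a factorization coming from a D-optimal design. This second √r_k gives
the factor r_k in the theorem.

Noise: the weighted noise unfolding is a Gaussian matrix whose row and column variance sums are at
most σ² μ_k². Its Hermitian dilation is a Gaussian matrix series; Gaussian integration by parts
gives a recursion for its trace moments (`integral_trace_matSeries_pow_le`), and Markov's inequality
with exponent about log D, where D = `dimSum d k`, bounds the norm outside an event of probability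
1/D. A union bound over k finishes. -/

namespace TensorCompletion

/-! ### Spectral norm: bilinear forms, rank and Schur multipliers -/

section SpecNorm

open scoped Matrix.Norms.L2Operator

variable {a b c : Type} [Fintype a] [Fintype b] [Fintype c] [DecidableEq b] [DecidableEq c]

theorem specNorm_nonneg (M : Matrix a b ℝ) : 0 ≤ specNorm M := norm_nonneg _

theorem specNorm_add_le (M N : Matrix a b ℝ) : specNorm (M + N) ≤ specNorm M + specNorm N :=
  norm_add_le _ _

theorem specNorm_sub_le (M N : Matrix a b ℝ) : specNorm (M - N) ≤ specNorm M + specNorm N :=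
  norm_sub_le _ _

theorem specNorm_sub_comm (M N : Matrix a b ℝ) : specNorm (M - N) = specNorm (N - M) :=
  norm_sub_rev _ _

theorem sum_sq_mulVec_le (M : Matrix a b ℝ) (x : b → ℝ) :
    ∑ i, (M.mulVec x) i ^ 2 ≤ specNorm M ^ 2 * ∑ j, x j ^ 2 := by
  have h := Matrix.l2_opNorm_mulVec M (WithLp.toLp 2 x)
  have h2 := pow_le_pow_left₀ (norm_nonneg _) h 2
  rw [mul_pow, EuclideanSpace.norm_sq_eq, EuclideanSpace.norm_sq_eq] at h2
  simpa [specNorm] using h2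

theorem specNorm_le_of_forall {M : Matrix a b ℝ} {t : ℝ} (ht : 0 ≤ t)
    (h : ∀ x : b → ℝ, ∑ i, (M.mulVec x) i ^ 2 ≤ t ^ 2 * ∑ j, x j ^ 2) : specNorm M ≤ t := by
  unfold specNorm
  rw [Matrix.l2_opNorm_def]
  refine ContinuousLinearMap.opNorm_le_bound _ ht fun x => ?_
  refine le_of_sq_le_sq ?_ (by positivity)
  rw [mul_pow, EuclideanSpace.norm_sq_eq, EuclideanSpace.norm_sq_eq]
  simpa using h x

/-- A bilinear-form criterion for the spectral norm. -/
theorem specNorm_le_of_bilin {M : Matrix a b ℝ} {t : ℝ} (ht : 0 ≤ t)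
    (h : ∀ (x : a → ℝ) (y : b → ℝ),
      (x ⬝ᵥ M.mulVec y) ^ 2 ≤ t ^ 2 * (∑ i, x i ^ 2) * ∑ j, y j ^ 2) : specNorm M ≤ t := by
  refine specNorm_le_of_forall ht fun y => ?_
  -- Testing against x = M y gives s² ≤ t² s ‖y‖² with s = ‖M y‖²; dividing by s is possible unless
  -- s = 0.
  have h1 := h (M.mulVec y) y
  have h2 : (M.mulVec y) ⬝ᵥ M.mulVec y = ∑ i, (M.mulVec y) i ^ 2 := by
    simp [dotProduct, sq]
  rw [h2] at h1
  set s := ∑ i, (M.mulVec y) i ^ 2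
  have hs : 0 ≤ s := Finset.sum_nonneg fun i _ => sq_nonneg _
  rcases hs.eq_or_lt with h0 | h0
  · rw [← h0]; positivity
  · nlinarith

theorem bilin_sq_le (M : Matrix a b ℝ) (x : a → ℝ) (y : b → ℝ) :
    (x ⬝ᵥ M.mulVec y) ^ 2 ≤ specNorm M ^ 2 * (∑ i, x i ^ 2) * ∑ j, y j ^ 2 := by
  have h1 := Finset.sum_mul_sq_le_sq_mul_sq Finset.univ x (M.mulVec y)
  have h2 := sum_sq_mulVec_le M y
  have h3 : 0 ≤ ∑ i, x i ^ 2 := Finset.sum_nonneg fun i _ => sq_nonneg _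
  calc (x ⬝ᵥ M.mulVec y) ^ 2 ≤ (∑ i, x i ^ 2) * ∑ i, (M.mulVec y) i ^ 2 := h1
    _ ≤ (∑ i, x i ^ 2) * (specNorm M ^ 2 * ∑ j, y j ^ 2) := by gcongr
    _ = _ := by ring

/-- The left side is the trace of MᵀM, a sum of eigenvalues of which only `M.rank` are nonzero, each
at most ‖M‖² by evaluating M on a unit eigenvector. -/
theorem sum_sq_le_rank_mul_specNorm_sq (M : Matrix a b ℝ) :
    ∑ i, ∑ j, M i j ^ 2 ≤ M.rank * specNorm M ^ 2 := by
  have hH : (M.transpose * M).IsHermitian := by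
    have := Matrix.isHermitian_conjTranspose_mul_self M
    rwa [Matrix.conjTranspose_eq_transpose_of_trivial] at this
  have hr : M.rank = Fintype.card {i // hH.eigenvalues i ≠ 0} := by
    rw [← hH.rank_eq_card_non_zero_eigs, Matrix.rank_transpose_mul_self]
  have htr : ∑ i, ∑ j, M i j ^ 2 = ∑ i, hH.eigenvalues i := by
    have := hH.trace_eq_sum_eigenvalues
    simp only [RCLike.ofReal_real_eq_id, id] at this
    rw [← this, Finset.sum_comm]
    simp [Matrix.trace, Matrix.mul_apply, sq]
  have hev : ∀ j, hH.eigenvalues j ≤ specNorm M ^ 2 := by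
    intro j
    set v : b → ℝ := ⇑(hH.eigenvectorBasis j) with hv
    have h1 := hH.mulVec_eigenvectorBasis j
    have hn : ∑ k, v k ^ 2 = 1 := by
      have := (hH.eigenvectorBasis.orthonormal.1 j)
      have h2 : ‖hH.eigenvectorBasis j‖ ^ 2 = 1 := by rw [this]; norm_num
      rw [EuclideanSpace.norm_sq_eq] at h2
      simpa using h2
    have h3 := sum_sq_mulVec_le M v
    rw [hn, mul_one] at h3
    have h4 : ∑ i, (M.mulVec v) i ^ 2 = hH.eigenvalues j := by
      have : ∑ i, (M.mulVec v) i ^ 2 = v ⬝ᵥ (M.transpose * M).mulVec v := by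
        rw [← Matrix.mulVec_mulVec, Matrix.dotProduct_mulVec, Matrix.vecMul_transpose]
        simp [dotProduct, sq]
      rw [this, h1, dotProduct_smul]
      simp only [dotProduct, smul_eq_mul]
      have : ∑ i, v i * v i = 1 := by rw [← hn]; simp [sq]
      rw [← hv, this, mul_one]
    linarith
  rw [htr, hr]
  calc ∑ i, hH.eigenvalues i = ∑ i with hH.eigenvalues i ≠ 0, hH.eigenvalues i := by
        rw [Finset.sum_filter_ne_zero]
    _ ≤ ∑ i with hH.eigenvalues i ≠ 0, specNorm M ^ 2 := Finset.sum_le_sum fun i _ => hev i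
    _ = _ := by
        rw [Finset.sum_const, nsmul_eq_mul, Fintype.card_subtype]

/-- Schur multipliers: if the rows of `u` and `v` are bounded by `α` and `β`, then the entrywise
product with `u * vᵀ` has norm at most `α * β` on matrices with the spectral norm. -/
theorem specNorm_schur_le {l : Type} [Fintype l] (A : Matrix a b ℝ) (u : Matrix a l ℝ)
    (v : Matrix b l ℝ) {α β : ℝ} (hα : 0 ≤ α) (hβ : 0 ≤ β)
    (hu : ∀ i, ∑ k, u i k ^ 2 ≤ α ^ 2) (hv : ∀ j, ∑ k, v j k ^ 2 ≤ β ^ 2) :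
    specNorm (Matrix.of fun i j => A i j * (u * v.transpose) i j) ≤ α * β * specNorm A := by
  have hA := specNorm_nonneg A
  refine specNorm_le_of_bilin (by positivity) fun x y => ?_
  -- The form of the Schur product is a sum over k of forms of A at the vectors x ⊙ u_k and y ⊙ v_k.
  -- Bounding each by ‖A‖ and applying Cauchy–Schwarz in k leaves only the row norms of u and v.
  have key : x ⬝ᵥ (Matrix.of fun i j => A i j * (u * v.transpose) i j).mulVec y
      = ∑ k, (fun i => x i * u i k) ⬝ᵥ A.mulVec (fun j => y j * v j k) := by
    simp only [dotProduct, Matrix.mulVec, Matrix.of_apply, Matrix.mul_apply,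
      Matrix.transpose_apply, Finset.mul_sum, Finset.sum_mul]
    rw [Finset.sum_comm (s := (Finset.univ : Finset l))]
    refine Finset.sum_congr rfl fun i _ => ?_
    rw [Finset.sum_comm]
    exact Finset.sum_congr rfl fun k _ => Finset.sum_congr rfl fun j _ => by ring
  have hx : ∑ k, ∑ i, (x i * u i k) ^ 2 ≤ α ^ 2 * ∑ i, x i ^ 2 := by
    rw [Finset.sum_comm, Finset.mul_sum]
    refine Finset.sum_le_sum fun i _ => ?_
    simp only [mul_pow]
    rw [← Finset.mul_sum, mul_comm]
    exact mul_le_mul_of_nonneg_right (hu i) (sq_nonneg _)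
  have hy : ∑ k, ∑ j, (y j * v j k) ^ 2 ≤ β ^ 2 * ∑ j, y j ^ 2 := by
    rw [Finset.sum_comm, Finset.mul_sum]
    refine Finset.sum_le_sum fun i _ => ?_
    simp only [mul_pow]
    rw [← Finset.mul_sum, mul_comm]
    exact mul_le_mul_of_nonneg_right (hv i) (sq_nonneg _)
  rw [key]
  have h0 : ∀ k, |(fun i => x i * u i k) ⬝ᵥ A.mulVec (fun j => y j * v j k)| ≤
      specNorm A * (√(∑ i, (x i * u i k) ^ 2) * √(∑ j, (y j * v j k) ^ 2)) := by
    intro k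
    refine abs_le_of_sq_le_sq ?_ (by positivity)
    have hp : 0 ≤ ∑ i, (x i * u i k) ^ 2 := Finset.sum_nonneg fun i _ => sq_nonneg _
    have hq : 0 ≤ ∑ j, (y j * v j k) ^ 2 := Finset.sum_nonneg fun i _ => sq_nonneg _
    rw [mul_pow, mul_pow, Real.sq_sqrt hp, Real.sq_sqrt hq, ← mul_assoc]
    exact bilin_sq_le A _ _
  have h1 := (Finset.abs_sum_le_sum_abs (fun k =>
    (fun i => x i * u i k) ⬝ᵥ A.mulVec (fun j => y j * v j k)) Finset.univ).trans
    (Finset.sum_le_sum fun k _ => h0 k)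
  rw [← Finset.mul_sum] at h1
  have h2 := Finset.sum_mul_sq_le_sq_mul_sq Finset.univ
    (fun k => √(∑ i, (x i * u i k) ^ 2)) (fun k => √(∑ j, (y j * v j k) ^ 2))
  have h3 : ∑ k, √(∑ i, (x i * u i k) ^ 2) ^ 2 = ∑ k, ∑ i, (x i * u i k) ^ 2 :=
    Finset.sum_congr rfl fun k _ => Real.sq_sqrt (Finset.sum_nonneg fun i _ => sq_nonneg _)
  have h4 : ∑ k, √(∑ j, (y j * v j k) ^ 2) ^ 2 = ∑ k, ∑ j, (y j * v j k) ^ 2 :=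
    Finset.sum_congr rfl fun k _ => Real.sq_sqrt (Finset.sum_nonneg fun i _ => sq_nonneg _)
  rw [h3, h4] at h2
  have hny : 0 ≤ ∑ k, ∑ j, (y j * v j k) ^ 2 :=
    Finset.sum_nonneg fun k _ => Finset.sum_nonneg fun i _ => sq_nonneg _
  have hnx : 0 ≤ ∑ i, x i ^ 2 := Finset.sum_nonneg fun i _ => sq_nonneg _
  rw [← sq_abs]
  calc _ ≤ (specNorm A * ∑ k, √(∑ i, (x i * u i k) ^ 2) * √(∑ j, (y j * v j k) ^ 2)) ^ 2 :=
        pow_le_pow_left₀ (abs_nonneg _) h1 2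
    _ ≤ specNorm A ^ 2 * ((∑ k, ∑ i, (x i * u i k) ^ 2) * ∑ k, ∑ j, (y j * v j k) ^ 2) := by
        rw [mul_pow]; gcongr
    _ ≤ specNorm A ^ 2 * ((α ^ 2 * ∑ i, x i ^ 2) * (β ^ 2 * ∑ j, y j ^ 2)) := by gcongr
    _ = _ := by ring

end SpecNorm

/-! ### Optimal designs and factorizations with bounded rows -/

section Optimal

variable {a : Type*} [Fintype a] {r : ℕ}

/-- The information matrix of the design `p` on the rows of `X`. -/
noncomputable def infoMatrix (X : Matrix a (Fin r) ℝ) (p : a → ℝ) : Matrix (Fin r) (Fin r) ℝ :=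
  ∑ i, p i • Matrix.vecMulVec (X i) (X i)

theorem dotProduct_infoMatrix_mulVec (X : Matrix a (Fin r) ℝ) (p : a → ℝ) (y : Fin r → ℝ) :
    y ⬝ᵥ (infoMatrix X p).mulVec y = ∑ i, p i * (X.mulVec y) i ^ 2 := by
  simp only [infoMatrix, Matrix.sum_mulVec, dotProduct_sum]
  refine Finset.sum_congr rfl fun i _ => ?_
  rw [Matrix.smul_mulVec, dotProduct_smul, Matrix.vecMulVec_mulVec, dotProduct_smul]
  simp [Matrix.mulVec, dotProduct_comm y, sq]

theorem infoMatrix_isHermitian (X : Matrix a (Fin r) ℝ) (p : a → ℝ) :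
    (infoMatrix X p).IsHermitian := by
  ext i j
  simp [infoMatrix, Matrix.sum_apply, Matrix.vecMulVec_apply, mul_comm]

theorem infoMatrix_posSemidef (X : Matrix a (Fin r) ℝ) {p : a → ℝ} (hp : ∀ i, 0 ≤ p i) :
    (infoMatrix X p).PosSemidef := by
  refine Matrix.PosSemidef.of_dotProduct_mulVec_nonneg (infoMatrix_isHermitian X p) fun y => ?_
  simp only [star_trivial]
  rw [dotProduct_infoMatrix_mulVec]
  exact Finset.sum_nonneg fun i _ => mul_nonneg (hp i) (sq_nonneg _)

/-- Kiefer–Wolfowitz: a determinant-maximising design has leverage scores at most `r`. -/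
theorem exists_optimal_design [Nonempty a] (X : Matrix a (Fin r) ℝ)
    (hX : Function.Injective X.mulVec) :
    ∃ p : a → ℝ, (∀ i, 0 ≤ p i) ∧ ∑ i, p i = 1 ∧ (infoMatrix X p).PosDef ∧
      ∀ i, X i ⬝ᵥ (infoMatrix X p)⁻¹.mulVec (X i) ≤ r := by
  classical
  have hcont : Continuous fun p : a → ℝ => (infoMatrix X p).det := by
    unfold infoMatrix; fun_prop
  obtain ⟨p, hp, hmax⟩ := (isCompact_stdSimplex ℝ a).exists_isMaxOn
    ⟨_, single_mem_stdSimplex ℝ (Classical.arbitrary a)⟩ hcont.continuousOn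
  -- Injectivity of X makes the uniform design nondegenerate, so the maximal determinant is positive
  -- and M is invertible.
  have hunif : 0 < (infoMatrix X fun _ => (Fintype.card a : ℝ)⁻¹).det := by
    refine Matrix.PosDef.det_pos ?_
    refine Matrix.PosDef.of_dotProduct_mulVec_pos (infoMatrix_isHermitian X _) fun {y} hy => ?_
    simp only [star_trivial]
    rw [dotProduct_infoMatrix_mulVec, ← Finset.mul_sum]
    have hne : X.mulVec y ≠ 0 := fun h => hy (hX (by rw [h, Matrix.mulVec_zero]))
    obtain ⟨i, hi⟩ := Function.ne_iff.mp hne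
    have : 0 < ∑ i, (X.mulVec y) i ^ 2 :=
      Finset.sum_pos' (fun i _ => sq_nonneg _) ⟨i, Finset.mem_univ _, by
        have : (X.mulVec y) i ≠ 0 := hi
        positivity⟩
    have : 0 < Fintype.card a := Fintype.card_pos
    positivity
  have hdet : 0 < (infoMatrix X p).det := by
    refine hunif.trans_le (hmax ?_)
    refine ⟨fun _ => by positivity, ?_⟩
    simp
  have hpd : (infoMatrix X p).PosDef :=
    (infoMatrix_posSemidef X hp.1).posDef_iff_det_ne_zero.mpr hdet.ne'
  refine ⟨p, hp.1, hp.2, hpd, fun i => ?_⟩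
  set M := infoMatrix X p with hM
  set q := X i ⬝ᵥ M⁻¹.mulVec (X i) with hq
  by_contra! hlt
  have hr : r ≠ 0 := by
    rintro rfl
    simp [hq, dotProduct] at hlt
  -- move the design towards the one concentrated at `i`
  have hbound : ∀ t ∈ Set.Ioo (0 : ℝ) 1, (1 - t) ^ (r - 1) * (1 + (q - 1) * t) ≤ 1 := by
    intro t ht
    have h1t : 0 < 1 - t := by linarith [ht.2]
    have hmem : (1 - t) • p + t • Pi.single i 1 ∈ stdSimplex ℝ a :=
      convex_stdSimplex ℝ a hp (single_mem_stdSimplex ℝ i) h1t.le ht.1.le (by ring)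
    have hle : (infoMatrix X ((1 - t) • p + t • Pi.single i 1)).det ≤ M.det := hmax hmem
    have hexp : infoMatrix X ((1 - t) • p + t • Pi.single i 1) =
        (1 - t) • (M + Matrix.replicateCol Unit ((t / (1 - t)) • X i) *
          Matrix.replicateRow Unit (X i)) := by
      have h1 : infoMatrix X ((1 - t) • p + t • Pi.single i 1) =
          (1 - t) • M + t • Matrix.vecMulVec (X i) (X i) := by
        simp only [hM, infoMatrix, Pi.add_apply, Pi.smul_apply, add_smul, Finset.sum_add_distrib,
          smul_eq_mul, mul_smul, ← Finset.smul_sum]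
        congr 2
        rw [Finset.sum_eq_single i]
        · simp
        · intro j _ hj; simp [hj]
        · simp
      rw [h1, smul_add]
      congr 1
      ext k l
      simp only [Matrix.smul_apply, Matrix.vecMulVec_apply, smul_eq_mul, Matrix.mul_apply,
        Matrix.replicateCol_apply, Matrix.replicateRow_apply, Finset.univ_unique,
        Finset.sum_singleton, Pi.smul_apply]
      field_simp
    -- The perturbation is of rank one, so the matrix determinant lemma turns maximality into a
    -- scalar inequality in t and the leverage q.
    rw [hexp, Matrix.det_smul, Matrix.det_add_replicateCol_mul_replicateRow
      (isUnit_iff_ne_zero.mpr hdet.ne'), Fintype.card_fin] at hle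
    have hdu : (1 + Matrix.replicateRow Unit (X i) * M⁻¹ *
        Matrix.replicateCol Unit ((t / (1 - t)) • X i)).det = 1 + t / (1 - t) * q := by
      rw [Matrix.det_unique, Matrix.mul_assoc, Matrix.add_apply, Matrix.one_apply_eq, hq]
      congr 1
      simp only [Matrix.mul_apply, Matrix.replicateRow_apply, Matrix.replicateCol_apply,
        dotProduct, Matrix.mulVec, Finset.mul_sum, Pi.smul_apply, smul_eq_mul]
      exact Finset.sum_congr rfl fun k _ => Finset.sum_congr rfl fun j _ => by ring
    rw [hdu] at hle
    have h2 : (1 - t) ^ r * (1 + t / (1 - t) * q) ≤ 1 := by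
      by_contra! h
      nlinarith
    calc (1 - t) ^ (r - 1) * (1 + (q - 1) * t)
        = (1 - t) ^ (r - 1) * (1 - t) * (1 + t / (1 - t) * q) := by field_simp; ring
      _ = (1 - t) ^ r * (1 + t / (1 - t) * q) := by
        rw [← pow_succ, Nat.sub_add_cancel (Nat.pos_of_ne_zero hr)]
      _ ≤ 1 := h2
  have hr1 : ((r - 1 : ℕ) : ℝ) = r - 1 := by
    rw [Nat.cast_sub (Nat.pos_of_ne_zero hr)]; simp
  have hrr : (1 : ℝ) ≤ r := by exact_mod_cast Nat.pos_of_ne_zero hr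
  set m : ℝ := r - 1 with hm
  have hm0 : 0 ≤ m := by linarith
  set e : ℝ := m * (q - 1) with he
  have he0 : 0 ≤ e := mul_nonneg hm0 (by linarith)
  -- Bernoulli's inequality bounds the left side of `hbound` below by 1 + t((q - r) - e t). This
  -- exceeds 1 as soon as 0 < t and e t < q - r; the denominator ensures both, and also t < 1.
  set t : ℝ := (q - r) / (q - r + e + 1) with ht
  have hden : 0 < q - r + e + 1 := by linarith
  have ht0 : 0 < t := div_pos (by linarith) hden
  have ht1 : t < 1 := by rw [ht, div_lt_one hden]; linarith
  have h3 := hbound t ⟨ht0, ht1⟩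
  have h4 : 1 - m * t ≤ (1 - t) ^ (r - 1) := by
    have := one_add_mul_le_pow (a := -t) (by linarith) (r - 1)
    rw [hr1] at this
    have h5 : (1 : ℝ) + -t = 1 - t := by ring
    rw [h5] at this
    linarith
  have h5 : 0 < 1 + (q - 1) * t := by
    have : 0 < (q - 1) * t := mul_pos (by linarith) ht0
    linarith
  have h6 : (1 - m * t) * (1 + (q - 1) * t) ≤ 1 :=
    (mul_le_mul_of_nonneg_right h4 h5.le).trans h3
  have h7 : t * (q - r + e + 1) = q - r := by rw [ht]; field_simp
  have h8 : t * ((q - r) - e * t) ≤ 0 := by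
    have : (1 - m * t) * (1 + (q - 1) * t) = 1 + t * ((q - r) - e * t) := by rw [he, hm]; ring
    linarith
  have h9 : 0 < (q - r) - e * t := by nlinarith
  nlinarith [mul_pos ht0 h9]

/-- The columns of X are a basis of the column space and Y holds the coordinates of the columns of
B. Injectivity of X is what the optimal design requires. -/
theorem exists_mul_eq_of_rank {a b : Type*} [Fintype a] [Fintype b] (B : Matrix a b ℝ) :
    ∃ (X : Matrix a (Fin B.rank) ℝ) (Y : Matrix (Fin B.rank) b ℝ),
      Function.Injective X.mulVec ∧ B = X * Y := by
  classical
  let e : Module.Basis (Fin B.rank) ℝ (LinearMap.range B.mulVecLin) :=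
    Module.finBasisOfFinrankEq ℝ _ rfl
  have hmem : ∀ j, B.col j ∈ LinearMap.range B.mulVecLin := fun j =>
    ⟨Pi.single j 1, by simp⟩
  refine ⟨Matrix.of fun i k => (e k : a → ℝ) i, Matrix.of fun k j => e.repr ⟨B.col j, hmem j⟩ k,
    ?_, ?_⟩
  · have hmv : ∀ y, (Matrix.of fun i k => (e k : a → ℝ) i).mulVec y =
        ((∑ k, y k • e k : LinearMap.range B.mulVecLin) : a → ℝ) := by
      intro y
      ext i
      simp [Matrix.mulVec, dotProduct, mul_comm]
    intro y z hyz
    simp only [hmv] at hyz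
    have h := Subtype.ext hyz
    ext k
    have h1 := congrArg (fun v => e.repr v k) h
    simpa only [Module.Basis.repr_sum_self] using h1
  · ext i j
    have h := congrArg (fun v : LinearMap.range B.mulVecLin => (v : a → ℝ) i)
      (e.sum_repr ⟨B.col j, hmem j⟩)
    simp only [Matrix.mul_apply, Matrix.of_apply]
    simp [-Module.Basis.sum_repr] at h
    simpa [mul_comm] using h.symm

open scoped MatrixOrder in
/-- A matrix of rank `r` with entries bounded by `c` factors as `u * vᵀ` where the rows of `u` have
norm at most `√r` and the rows of `v` have norm at most `c`. -/
theorem exists_bounded_factorization {a b : Type*} [Fintype a] [Fintype b] [Nonempty a]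
    (B : Matrix a b ℝ) {c : ℝ} (hB : ∀ i j, |B i j| ≤ c) :
    ∃ (u : Matrix a (Fin B.rank) ℝ) (v : Matrix b (Fin B.rank) ℝ), B = u * v.transpose ∧
      (∀ i, ∑ k, u i k ^ 2 ≤ B.rank) ∧ ∀ j, ∑ k, v j k ^ 2 ≤ c ^ 2 := by
  classical
  obtain ⟨X, Y, hX, hXY⟩ := exists_mul_eq_of_rank B
  obtain ⟨p, hp0, hp1, hpd, hlev⟩ := exists_optimal_design X hX
  set M := infoMatrix X p with hM
  obtain ⟨S, hS⟩ : ∃ S : Matrix (Fin B.rank) (Fin B.rank) ℝ, M = S.transpose * S := by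
    obtain ⟨S, hS⟩ := CStarAlgebra.nonneg_iff_eq_star_mul_self.mp hpd.posSemidef.nonneg
    exact ⟨S, by
      rw [hS, Matrix.star_eq_conjTranspose, Matrix.conjTranspose_eq_transpose_of_trivial]⟩
  have hSdet : IsUnit S.det := by
    have := hpd.det_pos.ne'
    rw [hS, Matrix.det_mul] at this
    exact isUnit_iff_ne_zero.mpr (right_ne_zero_of_mul this)
  -- Whitening by M = SᵀS: squared row norms of X S⁻¹ are the leverage scores, at most the rank,
  -- while those of (S Y)ᵀ are the p-averages ∑ p_i B_ij², at most c².
  refine ⟨X * S⁻¹, (S * Y).transpose, ?_, fun i => ?_, fun j => ?_⟩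
  · rw [Matrix.transpose_transpose, Matrix.mul_assoc, ← Matrix.mul_assoc S⁻¹,
      Matrix.nonsing_inv_mul _ hSdet, Matrix.one_mul]
    exact hXY
  · refine le_trans (le_of_eq ?_) (hlev i)
    have hMinv : M⁻¹ = S⁻¹ * S⁻¹.transpose := by
      rw [hS, Matrix.mul_inv_rev, Matrix.transpose_nonsing_inv]
    rw [hMinv, ← Matrix.mulVec_mulVec, Matrix.dotProduct_mulVec, Matrix.mulVec_transpose]
    simp [dotProduct, sq, Matrix.mul_apply, Matrix.vecMul]
  · have h1 : ∑ k, (S * Y).transpose j k ^ 2 = (Y.col j) ⬝ᵥ M.mulVec (Y.col j) := by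
      rw [hS, ← Matrix.mulVec_mulVec, Matrix.dotProduct_mulVec, Matrix.vecMul_transpose]
      simp [dotProduct, sq, Matrix.mul_apply, Matrix.mulVec]
    rw [h1, hM, dotProduct_infoMatrix_mulVec]
    calc ∑ i, p i * (X.mulVec (Y.col j)) i ^ 2 ≤ ∑ i, p i * c ^ 2 := by
          refine Finset.sum_le_sum fun i _ => mul_le_mul_of_nonneg_left ?_ (hp0 i)
          have : (X.mulVec (Y.col j)) i = B i j := by
            conv_rhs => rw [hXY]
            rfl
          rw [this, ← sq_abs]
          exact pow_le_pow_left₀ (abs_nonneg _) (hB i j) 2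
      _ = c ^ 2 := by rw [← Finset.sum_mul, hp1, one_mul]

end Optimal

/-- The factorization u vᵀ of B with row norms at most √rank and c makes B a Schur multiplier. A
single factor √rank is essential here: it becomes r_k once the passage to the Frobenius norm adds
another. -/
theorem specNorm_hadamard_le {a b : Type} [Fintype a] [Fintype b] [DecidableEq b] [Nonempty a]
    (A B : Matrix a b ℝ) {c : ℝ} (hc : 0 ≤ c) (hB : ∀ i j, |B i j| ≤ c) :
    specNorm (Matrix.of fun i j => A i j * B i j) ≤ √B.rank * c * specNorm A := by
  obtain ⟨u, v, huv, hu, hv⟩ := exists_bounded_factorization B hB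
  have := specNorm_schur_le A u v (Real.sqrt_nonneg B.rank) hc
    (fun i => by rw [Real.sq_sqrt (Nat.cast_nonneg _)]; exact hu i) hv
  rwa [← huv] at this

/-! ### Errors of orthogonal projections onto singular subspaces -/

section Projections

variable {a b : Type} [Fintype a] [Fintype b]

theorem sum_sq_eq_trace (N : Matrix a b ℝ) :
    ∑ i, ∑ j, N i j ^ 2 = (N.transpose * N).trace := by
  rw [Finset.sum_comm]
  simp [Matrix.trace, Matrix.mul_apply, sq]

variable [DecidableEq a]

theorem sum_sq_projection_add {P : Matrix a a ℝ} (hs : P.transpose = P) (hi : P * P = P)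
    (N : Matrix a b ℝ) :
    ∑ i, ∑ j, (P * N) i j ^ 2 + ∑ i, ∑ j, ((1 - P : Matrix a a ℝ) * N) i j ^ 2 =
      ∑ i, ∑ j, N i j ^ 2 := by
  simp only [sum_sq_eq_trace]
  rw [← Matrix.trace_add]
  congr 1
  have h1 : (P * N).transpose * (P * N) = N.transpose * (P * N) := by
    rw [Matrix.transpose_mul, hs, Matrix.mul_assoc, ← Matrix.mul_assoc P, hi]
  have h2 : ((1 - P) * N).transpose * ((1 - P) * N) = N.transpose * N - N.transpose * (P * N) := by
    rw [Matrix.sub_mul, Matrix.one_mul, Matrix.transpose_sub, Matrix.sub_mul, Matrix.mul_sub,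
      Matrix.mul_sub, h1, Matrix.transpose_mul, hs, Matrix.mul_assoc]
    simp
  rw [h1, h2]
  abel

theorem sum_sq_projection_le {P : Matrix a a ℝ} (hs : P.transpose = P) (hi : P * P = P)
    (N : Matrix a b ℝ) : ∑ i, ∑ j, (P * N) i j ^ 2 ≤ ∑ i, ∑ j, N i j ^ 2 := by
  have h := sum_sq_projection_add hs hi N
  have : 0 ≤ ∑ i, ∑ j, ((1 - P : Matrix a a ℝ) * N) i j ^ 2 :=
    Finset.sum_nonneg fun _ _ => Finset.sum_nonneg fun _ _ => sq_nonneg _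
  linarith

variable [DecidableEq b]

theorem specNorm_projection_mul_le {P : Matrix a a ℝ} (hs : P.transpose = P) (hi : P * P = P)
    (N : Matrix a b ℝ) : specNorm (P * N) ≤ specNorm N := by
  refine specNorm_le_of_forall (specNorm_nonneg N) fun x => ?_
  refine le_trans ?_ (sum_sq_mulVec_le N x)
  have h := sum_sq_projection_le hs hi (Matrix.replicateCol Unit (N.mulVec x))
  rw [← Matrix.mulVec_mulVec]
  simpa [Matrix.mul_apply, Matrix.mulVec, dotProduct] using h

/-- The two error terms of the orthogonal projection onto the column space of a best approximation
`A` to `Y`, compared with a matrix `X` of rank at most `r`. -/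
theorem sum_sq_residual_le {r : ℕ} {X Y A : Matrix a b ℝ} {U : Matrix a (Fin r) ℝ}
    (hX : X.rank ≤ r) (hA : IsBestRankApprox Y r A) (hU : IsLeftSingularMatrix A U) :
    ∑ i, ∑ j, ((1 - U * U.transpose : Matrix a a ℝ) * X) i j ^ 2 ≤
      r * (2 * specNorm (X - Y)) ^ 2 := by
  obtain ⟨s, V, hUU, -, -, hAU⟩ := hU
  have hs : (U * U.transpose).transpose = U * U.transpose := by simp
  have hi : U * U.transpose * (U * U.transpose) = U * U.transpose := by
    rw [Matrix.mul_assoc, ← Matrix.mul_assoc U.transpose, hUU, Matrix.one_mul]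
  have hPA : U * U.transpose * A = A := by
    rw [hAU, Matrix.mul_assoc U (Matrix.diagonal s), Matrix.mul_assoc, ← Matrix.mul_assoc _ U, hUU,
      Matrix.one_mul]
  set P := U * U.transpose
  -- The columns of A lie in the range of P, so A may be subtracted freely. As X itself competes in
  -- the minimization, ‖A - Y‖ ≤ ‖X - Y‖, whence the factor 2.
  have h1 : (1 - P) * X = (1 - P) * (X - A) := by
    simp only [Matrix.sub_mul, Matrix.mul_sub, Matrix.one_mul, hPA]; simp
  have h2 : specNorm ((1 - P) * X) ≤ 2 * specNorm (X - Y) := by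
    rw [h1]
    refine (specNorm_projection_mul_le (by simp [hs]) ?_ _).trans ?_
    · rw [Matrix.sub_mul, Matrix.mul_sub, Matrix.mul_sub, hi]; simp
    · have h3 := hA.2 X hX
      have h4 : X - A = (X - Y) - (A - Y) := by abel
      rw [h4]
      have := specNorm_sub_le (X - Y) (A - Y)
      linarith
  have hr : ((1 - P) * X).rank ≤ r := (Matrix.rank_mul_le_right _ _).trans hX
  refine (sum_sq_le_rank_mul_specNorm_sq _).trans ?_
  have := specNorm_nonneg ((1 - P) * X)
  gcongr

theorem sum_sq_project_le {r : ℕ} (N : Matrix a b ℝ) {U : Matrix a (Fin r) ℝ}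
    (hUU : U.transpose * U = 1) :
    ∑ i, ∑ j, ((U * U.transpose) * N) i j ^ 2 ≤ r * specNorm N ^ 2 := by
  have hs : (U * U.transpose).transpose = U * U.transpose := by simp
  have hi : U * U.transpose * (U * U.transpose) = U * U.transpose := by
    rw [Matrix.mul_assoc, ← Matrix.mul_assoc U.transpose, hUU, Matrix.one_mul]
  have hr : (U * U.transpose * N).rank ≤ r :=
    (Matrix.rank_mul_le_left _ _).trans ((Matrix.rank_mul_le_left _ _).trans
      (by simpa using Matrix.rank_le_card_width U))
  refine (sum_sq_le_rank_mul_specNorm_sq _).trans ?_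
  have h0 := specNorm_nonneg (U * U.transpose * N)
  have := specNorm_projection_mul_le hs hi N
  gcongr

end Projections

/-! ### Unfoldings, mode products and the deterministic HOSVD bound -/

section Tensors

variable {n : ℕ} {d : Fin n → ℕ}

theorem frobNorm_eq_norm (T : Tensor d) :
    frobNorm T = ‖(WithLp.toLp 2 T : EuclideanSpace ℝ _)‖ := by
  rw [EuclideanSpace.norm_eq]
  simp [frobNorm]

theorem frobNorm_add_le (S T : Tensor d) : frobNorm (S + T) ≤ frobNorm S + frobNorm T := by
  simp only [frobNorm_eq_norm, WithLp.toLp_add]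
  exact norm_add_le _ _

theorem sum_sq_unfold (T : Tensor d) (k : Fin n) :
    ∑ a, ∑ b, unfold T k a b ^ 2 = ∑ i, T i ^ 2 := by
  rw [← Fintype.sum_prod_type']
  exact (Equiv.piSplitAt k (fun j => Fin (d j))).symm.sum_comp fun i => T i ^ 2

theorem frobNorm_eq_sqrt_unfold (T : Tensor d) (k : Fin n) :
    frobNorm T = √(∑ a, ∑ b, unfold T k a b ^ 2) := by
  rw [sum_sq_unfold, frobNorm]

theorem piSplitAt_symm_self (k : Fin n) (a : Fin (d k)) (b : CoIndex d k) :
    (Equiv.piSplitAt k (fun j => Fin (d j))).symm (a, b) k = a := by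
  simp [Equiv.piSplitAt]

theorem piSplitAt_symm_ne (k : Fin n) (a : Fin (d k)) (b : CoIndex d k) (j : Fin n) (h : j ≠ k) :
    (Equiv.piSplitAt k (fun j => Fin (d j))).symm (a, b) j = b ⟨j, h⟩ := by
  simp [Equiv.piSplitAt, h]

theorem update_piSplitAt_symm (k : Fin n) (a a' : Fin (d k)) (b : CoIndex d k) :
    Function.update ((Equiv.piSplitAt k (fun j => Fin (d j))).symm (a, b)) k a' =
      (Equiv.piSplitAt k (fun j => Fin (d j))).symm (a', b) := by
  ext j : 1
  rcases eq_or_ne j k with rfl | h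
  · rw [Function.update_self, piSplitAt_symm_self]
  · rw [Function.update_of_ne h, piSplitAt_symm_ne _ _ _ _ h, piSplitAt_symm_ne _ _ _ _ h]

theorem unfold_modeProd (T : Tensor d) (k : Fin n) (A : Matrix (Fin (d k)) (Fin (d k)) ℝ) :
    unfold (modeProd T k A) k = A * unfold T k := by
  ext a b
  simp only [unfold, modeProd, Matrix.of_apply, Matrix.mul_apply, piSplitAt_symm_self,
    update_piSplitAt_symm, mul_comm]

theorem modeProd_sub (S T : Tensor d) (k : Fin n) (A : Matrix (Fin (d k)) (Fin (d k)) ℝ) :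
    modeProd (S - T) k A = modeProd S k A - modeProd T k A := by
  ext i
  simp [modeProd, sub_mul]

/-- The iterated mode products along a list of modes. -/
def listModeProd (A : ∀ k : Fin n, Matrix (Fin (d k)) (Fin (d k)) ℝ) (l : List (Fin n))
    (T : Tensor d) : Tensor d :=
  l.foldl (fun X k => modeProd X k (A k)) T

theorem listModeProd_sub (A : ∀ k : Fin n, Matrix (Fin (d k)) (Fin (d k)) ℝ) (l : List (Fin n))
    (S T : Tensor d) : listModeProd A l (S - T) = listModeProd A l S - listModeProd A l T := by
  induction l generalizing S T with
  | nil => rfl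
  | cons k l ih =>
    simp only [listModeProd, List.foldl_cons] at ih ⊢
    rw [modeProd_sub, ih]

theorem frobNorm_modeProd_le (T : Tensor d) (k : Fin n) {P : Matrix (Fin (d k)) (Fin (d k)) ℝ}
    (hs : P.transpose = P) (hi : P * P = P) : frobNorm (modeProd T k P) ≤ frobNorm T := by
  rw [frobNorm_eq_sqrt_unfold _ k, frobNorm_eq_sqrt_unfold _ k, unfold_modeProd]
  exact Real.sqrt_le_sqrt (sum_sq_projection_le hs hi _)

variable {P : ∀ k : Fin n, Matrix (Fin (d k)) (Fin (d k)) ℝ}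

theorem frobNorm_listModeProd_le (hs : ∀ k, (P k).transpose = P k) (hi : ∀ k, P k * P k = P k)
    (l : List (Fin n)) (T : Tensor d) : frobNorm (listModeProd P l T) ≤ frobNorm T := by
  induction l generalizing T with
  | nil => rfl
  | cons k l ih => exact (ih _).trans (frobNorm_modeProd_le T k (hs k) (hi k))

/-- Telescoping: peeling off the first mode leaves a one-mode residual, on which the remaining
projections act as contractions. -/
theorem frobNorm_sub_listModeProd_le (hs : ∀ k, (P k).transpose = P k)
    (hi : ∀ k, P k * P k = P k) (l : List (Fin n)) (T : Tensor d) :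
    frobNorm (T - listModeProd P l T) ≤
      (l.map fun k => frobNorm (T - modeProd T k (P k))).sum := by
  induction l with
  | nil => simp [listModeProd, frobNorm]
  | cons k l ih =>
    have h : T - listModeProd P (k :: l) T =
        listModeProd P l (T - modeProd T k (P k)) + (T - listModeProd P l T) := by
      rw [listModeProd_sub]
      change T - listModeProd P l (modeProd T k (P k)) = _
      abel
    rw [h, List.map_cons, List.sum_cons]
    exact (frobNorm_add_le _ _).trans
      (add_le_add (frobNorm_listModeProd_le hs hi l _) ih)

/-- The deterministic error bound for the HOSVD of `Y`, as an estimate of a tensor `X` whose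
unfoldings have rank at most `r k`. -/
theorem frobNorm_sub_hosvd_le (hn : 1 ≤ n) {X Y : Tensor d} {r : Fin n → ℕ}
    (hX : ∀ k, (unfold X k).rank ≤ r k) {U : ∀ k : Fin n, Matrix (Fin (d k)) (Fin (r k)) ℝ}
    (hU : IsHOSVDFactors Y r U) :
    frobNorm (X - multiModeProd Y fun k => U k * (U k).transpose) ≤
      3 * ∑ k, √(r k) * specNorm (unfold (X - Y) k) := by
  choose A hA hAU using hU
  have hUU : ∀ k, (U k).transpose * U k = 1 := fun k => by
    obtain ⟨_, _, h, _⟩ := hAU k; exact h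
  set P : ∀ k : Fin n, Matrix (Fin (d k)) (Fin (d k)) ℝ := fun k => U k * (U k).transpose with hP
  have hs : ∀ k, (P k).transpose = P k := fun k => by simp [hP]
  have hi : ∀ k, P k * P k = P k := fun k => by
    simp only [hP]
    rw [Matrix.mul_assoc, ← Matrix.mul_assoc (U k).transpose, hUU, Matrix.one_mul]
  have hnn : ∀ k, 0 ≤ √(r k : ℝ) * specNorm (unfold (X - Y) k) := fun k =>
    mul_nonneg (Real.sqrt_nonneg _) (specNorm_nonneg _)
  have hdecomp : X - multiModeProd Y P =
      (X - listModeProd P (List.finRange n) X) + listModeProd P (List.finRange n) (X - Y) := by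
    rw [listModeProd_sub]
    change X - listModeProd P (List.finRange n) Y = _
    abel
  have h1 : frobNorm (X - listModeProd P (List.finRange n) X) ≤
      2 * ∑ k, √(r k) * specNorm (unfold (X - Y) k) := by
    refine (frobNorm_sub_listModeProd_le hs hi _ _).trans ?_
    rw [← Fin.sum_univ_def, Finset.mul_sum]
    refine Finset.sum_le_sum fun k _ => ?_
    rw [frobNorm_eq_sqrt_unfold _ k]
    have hres : unfold (X - modeProd X k (P k)) k = (1 - P k) * unfold X k := by
      rw [Matrix.sub_mul, Matrix.one_mul, ← unfold_modeProd]; rfl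
    rw [hres]
    refine (Real.sqrt_le_sqrt (sum_sq_residual_le (hX k) (hA k) (hAU k))).trans (le_of_eq ?_)
    have hsub : unfold X k - unfold Y k = unfold (X - Y) k := rfl
    rw [hsub, Real.sqrt_mul (Nat.cast_nonneg _), Real.sqrt_sq (by
      have := specNorm_nonneg (unfold (X - Y) k); positivity)]
    ring
  have h2 : frobNorm (listModeProd P (List.finRange n) (X - Y)) ≤
      ∑ k, √(r k) * specNorm (unfold (X - Y) k) := by
    -- One projection suffices to bring in the rank, so only mode 0 is used and the others merely
    -- contract; this needs n ≥ 1.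
    obtain ⟨m, rfl⟩ : ∃ m, n = m + 1 := ⟨n - 1, by omega⟩
    rw [List.finRange_succ]
    refine (frobNorm_listModeProd_le hs hi _ (modeProd (X - Y) 0 (P 0))).trans ?_
    refine le_trans ?_ (Finset.single_le_sum (fun k _ => hnn k) (Finset.mem_univ 0))
    rw [frobNorm_eq_sqrt_unfold _ 0, unfold_modeProd]
    refine (Real.sqrt_le_sqrt (sum_sq_project_le _ (hUU 0))).trans (le_of_eq ?_)
    rw [Real.sqrt_mul (Nat.cast_nonneg _), Real.sqrt_sq (specNorm_nonneg _)]
  rw [hdecomp]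
  refine (frobNorm_add_le _ _).trans ?_
  linarith

theorem hpow_outer_apply {w : ∀ k : Fin n, Fin (d k) → ℝ} (hw : ∀ i : Index d, 0 < outer w i)
    (α : ℝ) (i : Index d) : hpow (outer w) α i = ∏ k, |w k (i k)| ^ α := by
  rw [hpow, ← abs_of_pos (hw i), outer, Finset.abs_prod, Real.finsetProd_rpow]
  exact fun _ _ => abs_nonneg _

/-- An entrywise power of an outer product factors over the modes, so it multiplies the unfolding by
a diagonal matrix on each side. Absolute values appear because only the products of the entries of
w, not the entries, are known to be positive. -/
theorem rank_unfold_hadamard_hpow_le {w : ∀ k : Fin n, Fin (d k) → ℝ}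
    (hw : ∀ i : Index d, 0 < outer w i) (α : ℝ) (T : Tensor d) (k : Fin n) :
    (unfold (hadamard (hpow (outer w) α) T) k).rank ≤ (unfold T k).rank := by
  have h : unfold (hadamard (hpow (outer w) α) T) k =
      Matrix.diagonal (fun a => |w k a| ^ α) * unfold T k *
        Matrix.diagonal (fun b : CoIndex d k => ∏ j : {j : Fin n // j ≠ k}, |w j (b j)| ^ α) := by
    ext a b
    rw [Matrix.mul_diagonal, Matrix.diagonal_mul]
    simp only [unfold, hadamard, Matrix.of_apply, hpow_outer_apply hw]
    rw [Fintype.prod_eq_mul_prod_subtype_ne _ k, piSplitAt_symm_self]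
    have : ∀ j : {j : Fin n // j ≠ k},
        (Equiv.piSplitAt k (fun j => Fin (d j))).symm (a, b) j = b j := fun j =>
      piSplitAt_symm_ne k a b j j.2
    simp only [this]
    ring
  rw [h]
  exact (Matrix.rank_mul_le_left _ _).trans (Matrix.rank_mul_le_right _ _)

theorem abs_le_supNorm (T : Tensor d) (i : Index d) : |T i| ≤ supNorm T :=
  le_ciSup (f := fun i => |T i|) (Set.finite_range _).bddAbove i

theorem supNorm_nonneg (T : Tensor d) : 0 ≤ supNorm T := Real.iSup_nonneg fun _ => abs_nonneg _

end Tensors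

/-! ### Trace inequalities for symmetric matrices -/

section Diagonalization

variable {N : Type*} [Fintype N] [DecidableEq N]

theorem exists_orthogonal_diagonalization {G : Matrix N N ℝ} (hG : G.transpose = G) :
    ∃ (U : Matrix N N ℝ) (l : N → ℝ), U.transpose * U = 1 ∧ U * U.transpose = 1 ∧
      ∀ q : ℕ, G ^ q = U * Matrix.diagonal (fun j => l j ^ q) * U.transpose := by
  obtain ⟨U, l, h1, h2, h3⟩ : ∃ (U : Matrix N N ℝ) (l : N → ℝ), U.transpose * U = 1 ∧
      U * U.transpose = 1 ∧ G = U * Matrix.diagonal l * U.transpose := by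
    have hH : G.IsHermitian := by
      rw [Matrix.IsHermitian, Matrix.conjTranspose_eq_transpose_of_trivial, hG]
    have hstar : star (hH.eigenvectorUnitary : Matrix N N ℝ) =
        (hH.eigenvectorUnitary : Matrix N N ℝ).transpose := by
      rw [Matrix.star_eq_conjTranspose, Matrix.conjTranspose_eq_transpose_of_trivial]
    refine ⟨hH.eigenvectorUnitary, hH.eigenvalues, ?_, ?_, ?_⟩
    · rw [← hstar]; exact Unitary.coe_star_mul_self hH.eigenvectorUnitary
    · rw [← hstar]; exact Unitary.coe_mul_star_self hH.eigenvectorUnitary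
    · conv_lhs => rw [hH.spectral_theorem, Unitary.conjStarAlgAut_apply]
      rw [← hstar]
      rfl
  refine ⟨U, l, h1, h2, fun q => ?_⟩
  induction q with
  | zero => simp [h2]
  | succ q ih =>
    rw [pow_succ, ih, h3]
    calc _ = U * Matrix.diagonal (fun j => l j ^ q) * (U.transpose * U) *
          Matrix.diagonal l * U.transpose := by simp only [Matrix.mul_assoc]
      _ = _ := by
        rw [h1, Matrix.mul_one, Matrix.mul_assoc U, Matrix.diagonal_mul_diagonal]
        simp only [pow_succ]

/-- Rearrangement inequality for |x| and |y|; evenness of the total degree makes the right side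
insensitive to signs. -/
theorem pow_mul_pow_add_le (x y : ℝ) (q k : ℕ) (h : Even (q + k)) :
    x ^ q * y ^ k + y ^ q * x ^ k ≤ x ^ (q + k) + y ^ (q + k) := by
  have hx : x ^ (q + k) = |x| ^ q * |x| ^ k := by rw [← pow_add, h.pow_abs]
  have hy : y ^ (q + k) = |y| ^ q * |y| ^ k := by rw [← pow_add, h.pow_abs]
  have h1 : x ^ q * y ^ k ≤ |x| ^ q * |y| ^ k := by
    rw [← abs_pow, ← abs_pow, ← abs_mul]; exact le_abs_self _
  have h2 : y ^ q * x ^ k ≤ |y| ^ q * |x| ^ k := by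
    rw [← abs_pow, ← abs_pow, ← abs_mul]; exact le_abs_self _
  have h3 : 0 ≤ (|x| ^ q - |y| ^ q) * (|x| ^ k - |y| ^ k) := by
    rcases le_total |x| |y| with h | h
    · exact mul_nonneg_of_nonpos_of_nonpos
        (sub_nonpos.mpr (pow_le_pow_left₀ (abs_nonneg _) h _))
        (sub_nonpos.mpr (pow_le_pow_left₀ (abs_nonneg _) h _))
    · exact mul_nonneg (sub_nonneg.mpr (pow_le_pow_left₀ (abs_nonneg _) h _))
        (sub_nonneg.mpr (pow_le_pow_left₀ (abs_nonneg _) h _))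
  rw [hx, hy]
  nlinarith

/-- In an eigenbasis of G both traces are sums over B_ij² times monomials in the eigenvalues l_i,
l_j. After symmetrizing in i and j the comparison is termwise. -/
theorem trace_mul_pow_mul_pow_le {A G : Matrix N N ℝ} (hA : A.transpose = A)
    (hG : G.transpose = G) (q k : ℕ) (h : Even (q + k)) :
    (A * G ^ q * A * G ^ k).trace ≤ (A * A * G ^ (q + k)).trace := by
  obtain ⟨U, l, h1, h2, hpow⟩ := exists_orthogonal_diagonalization hG
  set B := U.transpose * A * U with hB
  have hBs : ∀ i j, B i j = B j i := fun i j => by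
    have : B.transpose = B := by
      rw [hB, Matrix.transpose_mul, Matrix.transpose_mul, hA, Matrix.transpose_transpose,
        Matrix.mul_assoc]
    exact congrFun (congrFun this j) i
  have e1 : (A * G ^ q * A * G ^ k).trace = ∑ i, ∑ j, B i j ^ 2 * (l j ^ q * l i ^ k) := by
    have : (A * G ^ q * A * G ^ k).trace = (B * Matrix.diagonal (fun j => l j ^ q) * B *
        Matrix.diagonal (fun j => l j ^ k)).trace := by
      rw [hpow, hpow, hB, ← Matrix.mul_assoc (A * _ * A), Matrix.trace_mul_comm _ U.transpose]
      simp only [Matrix.mul_assoc]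
    rw [this, Matrix.trace]
    refine Finset.sum_congr rfl fun i _ => ?_
    rw [Matrix.diag_apply, Matrix.mul_diagonal, Matrix.mul_apply, Finset.sum_mul]
    refine Finset.sum_congr rfl fun j _ => ?_
    rw [Matrix.mul_diagonal, hBs j i]; ring
  have e2 : (A * A * G ^ (q + k)).trace = ∑ i, ∑ j, B i j ^ 2 * l i ^ (q + k) := by
    have : (A * A * G ^ (q + k)).trace =
        (B * B * Matrix.diagonal (fun j => l j ^ (q + k))).trace := by
      have hAA : B * B = U.transpose * (A * A) * U := by
        rw [hB]
        calc _ = U.transpose * A * (U * U.transpose) * A * U := by simp only [Matrix.mul_assoc]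
          _ = _ := by rw [h2]; simp only [Matrix.mul_assoc, Matrix.one_mul]
      rw [hpow, hAA, ← Matrix.mul_assoc (A * A), Matrix.trace_mul_comm _ U.transpose]
      simp only [Matrix.mul_assoc]
    rw [this, Matrix.trace]
    refine Finset.sum_congr rfl fun i _ => ?_
    rw [Matrix.diag_apply, Matrix.mul_diagonal, Matrix.mul_apply, Finset.sum_mul]
    refine Finset.sum_congr rfl fun j _ => ?_
    rw [hBs j i]; ring
  have e1' : (A * G ^ q * A * G ^ k).trace = ∑ i, ∑ j, B i j ^ 2 * (l i ^ q * l j ^ k) := by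
    rw [e1, Finset.sum_comm]
    exact Finset.sum_congr rfl fun i _ => Finset.sum_congr rfl fun j _ => by rw [hBs]
  have e2' : (A * A * G ^ (q + k)).trace = ∑ i, ∑ j, B i j ^ 2 * l j ^ (q + k) := by
    rw [e2, Finset.sum_comm]
    exact Finset.sum_congr rfl fun i _ => Finset.sum_congr rfl fun j _ => by rw [hBs]
  suffices (A * G ^ q * A * G ^ k).trace + (A * G ^ q * A * G ^ k).trace ≤
      (A * A * G ^ (q + k)).trace + (A * A * G ^ (q + k)).trace by linarith
  nth_rewrite 1 [e1']
  nth_rewrite 1 [e2]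
  rw [e1, e2', ← Finset.sum_add_distrib, ← Finset.sum_add_distrib]
  refine Finset.sum_le_sum fun i _ => ?_
  rw [← Finset.sum_add_distrib, ← Finset.sum_add_distrib]
  refine Finset.sum_le_sum fun j _ => ?_
  rw [← mul_add, ← mul_add]
  exact mul_le_mul_of_nonneg_left (pow_mul_pow_add_le _ _ _ _ h) (sq_nonneg _)

theorem pow_even_diag_nonneg {G : Matrix N N ℝ} (hG : G.transpose = G) (k : ℕ) (i : N) :
    0 ≤ (G ^ (2 * k)) i i := by
  have h : G ^ (2 * k) = (G ^ k).transpose * G ^ k := by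
    rw [Matrix.transpose_pow, hG, ← pow_add, two_mul]
  rw [h, Matrix.mul_apply]
  exact Finset.sum_nonneg fun j _ => by rw [Matrix.transpose_apply]; exact mul_self_nonneg _

end Diagonalization

/-! ### Spectral norm from trace moments, and the Hermitian dilation -/

section TraceBound

variable {a b N : Type} [Fintype a] [Fintype b] [Fintype N] [DecidableEq a] [DecidableEq b]
  [DecidableEq N]

/-- The trace is the sum of the nonnegative numbers l_j^(2p), so it dominates each of them, and
every |l_j| is at most c. -/
theorem specNorm_le_of_trace_pow_le {G : Matrix N N ℝ} (hG : G.transpose = G) {c : ℝ} (hc : 0 ≤ c)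
    {p : ℕ} (hp : p ≠ 0) (h : (G ^ (2 * p)).trace ≤ c ^ (2 * p)) : specNorm G ≤ c := by
  obtain ⟨U, l, h1, h2, hpow⟩ := exists_orthogonal_diagonalization hG
  have htr : (G ^ (2 * p)).trace = ∑ j, l j ^ (2 * p) := by
    rw [hpow, Matrix.mul_assoc, Matrix.trace_mul_comm, Matrix.mul_assoc, h1, Matrix.mul_one,
      Matrix.trace_diagonal]
  have hl : ∀ j, l j ^ 2 ≤ c ^ 2 := by
    intro j
    have h3 : l j ^ (2 * p) ≤ c ^ (2 * p) := by
      refine le_trans ?_ h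
      rw [htr]
      exact Finset.single_le_sum (f := fun j => l j ^ (2 * p))
        (fun i _ => (even_two_mul p).pow_nonneg _) (Finset.mem_univ j)
    rw [pow_mul, pow_mul] at h3
    exact le_of_pow_le_pow_left₀ hp (by positivity) h3
  have hiso : ∀ (V : Matrix N N ℝ), V.transpose * V = 1 → ∀ x : N → ℝ,
      ∑ i, (V.mulVec x) i ^ 2 = ∑ i, x i ^ 2 := by
    intro V hV x
    have : (V.mulVec x) ⬝ᵥ (V.mulVec x) = x ⬝ᵥ x := by
      rw [Matrix.dotProduct_mulVec, ← Matrix.mulVec_transpose, Matrix.mulVec_mulVec, hV,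
        Matrix.one_mulVec]
    simpa [dotProduct, sq] using this
  refine specNorm_le_of_forall hc fun x => ?_
  have hG1 := hpow 1
  simp only [pow_one] at hG1
  rw [hG1, ← Matrix.mulVec_mulVec, ← Matrix.mulVec_mulVec, hiso U h1]
  rw [← hiso U.transpose (by rw [Matrix.transpose_transpose, h2]) x, Finset.mul_sum]
  refine Finset.sum_le_sum fun i _ => ?_
  rw [Matrix.mulVec_diagonal, mul_pow]
  exact mul_le_mul_of_nonneg_right (hl i) (sq_nonneg _)

theorem specNorm_le_dilation (B : Matrix a b ℝ) :
    specNorm B ≤ specNorm (Matrix.fromBlocks 0 B B.transpose 0) := by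
  refine specNorm_le_of_forall (specNorm_nonneg _) fun x => ?_
  have h := sum_sq_mulVec_le (Matrix.fromBlocks 0 B B.transpose 0) (Sum.elim 0 x)
  rw [Matrix.fromBlocks_mulVec] at h
  simpa using h

end TraceBound

/-! ### Gaussian integration by parts -/

section GaussianMoments

theorem integrable_pow_gaussianReal (v : ℝ≥0) (n : ℕ) :
    Integrable (fun x => x ^ n) (gaussianReal 0 v) := by
  have h := (memLp_id_gaussianReal' (μ := 0) (v := v) n (by simp)).integrable_norm_pow'
  refine h.mono (by fun_prop) (Filter.Eventually.of_forall fun x => ?_)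
  simp

theorem hasDerivAt_gaussianPDFReal {v : ℝ≥0} (hv : v ≠ 0) (x : ℝ) :
    HasDerivAt (gaussianPDFReal 0 v) (-(x / v) * gaussianPDFReal 0 v x) x := by
  have hv' : (v : ℝ) ≠ 0 := by exact_mod_cast hv
  unfold gaussianPDFReal
  have h : HasDerivAt (fun x : ℝ => -(x - 0) ^ 2 / (2 * v)) (-(x / v)) x := by
    have h1 := (((hasDerivAt_id x).sub_const 0).pow 2).neg.div_const (2 * (v : ℝ))
    refine h1.congr_deriv ?_
    simp
    field_simp
  have h2 := (h.exp).const_mul (√(2 * Real.pi * v))⁻¹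
  refine h2.congr_deriv ?_
  ring

/-- Integration by parts, since the density φ satisfies φ' = -(x/v) φ. For n = 0 the truncated
exponent n - 1 is harmless, being multiplied by n. Zero variance has no density and is treated
separately. -/
theorem integral_pow_succ_gaussianReal (v : ℝ≥0) (n : ℕ) :
    ∫ x, x ^ (n + 1) ∂gaussianReal 0 v = v * (n * ∫ x, x ^ (n - 1) ∂gaussianReal 0 v) := by
  rcases eq_or_ne v 0 with rfl | hv
  · simp [gaussianReal_zero_var]
  have hv' : (v : ℝ) ≠ 0 := by exact_mod_cast hv
  have hint : ∀ k : ℕ, Integrable (fun x : ℝ => x ^ k * gaussianPDFReal 0 v x) := by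
    intro k
    have h := integrable_pow_gaussianReal v k
    rw [gaussianReal_of_var_ne_zero _ hv, integrable_withDensity_iff_integrable_smul'
      (measurable_gaussianPDF 0 v) (Filter.Eventually.of_forall fun x => gaussianPDF_lt_top)] at h
    refine h.congr (Filter.Eventually.of_forall fun x => ?_)
    simp [toReal_gaussianPDF, mul_comm]
  have h := integral_mul_deriv_eq_deriv_mul_of_integrable
    (u := fun x : ℝ => x ^ n) (u' := fun x => n * x ^ (n - 1))
    (v := gaussianPDFReal 0 v) (v' := fun x => -(x / v) * gaussianPDFReal 0 v x)
    (fun x _ => hasDerivAt_pow n x) (fun x _ => hasDerivAt_gaussianPDFReal hv x)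
    (((hint (n + 1)).const_mul (-(v : ℝ)⁻¹)).congr
      (Filter.Eventually.of_forall fun x => by simp only [Pi.mul_apply]; ring))
    (((hint (n - 1)).const_mul n).congr
      (Filter.Eventually.of_forall fun x => by simp only [Pi.mul_apply]; ring))
    (hint n)
  rw [integral_gaussianReal_eq_integral_smul hv, integral_gaussianReal_eq_integral_smul hv]
  simp only [smul_eq_mul]
  have h1 : ∫ x : ℝ, x ^ n * (-(x / v) * gaussianPDFReal 0 v x) =
      -(v : ℝ)⁻¹ * ∫ x, gaussianPDFReal 0 v x * x ^ (n + 1) := by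
    rw [← integral_const_mul]; congr 1; ext x; ring
  have h2 : ∫ x : ℝ, n * x ^ (n - 1) * gaussianPDFReal 0 v x =
      n * ∫ x, gaussianPDFReal 0 v x * x ^ (n - 1) := by
    rw [← integral_const_mul]; congr 1; ext x; ring
  rw [h1, h2] at h
  field_simp at h
  linarith

variable {ι : Type*} [Fintype ι]

theorem integrable_eval_pi_gaussianReal (v : ℝ≥0) (p : MvPolynomial ι ℝ) :
    Integrable (fun x => MvPolynomial.eval x p) (Measure.pi fun _ : ι => gaussianReal 0 v) := by
  induction p using MvPolynomial.induction_on' with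
  | monomial a c =>
    simp only [MvPolynomial.eval_monomial, Finsupp.prod_fintype _ _ (fun i => pow_zero _)]
    exact (Integrable.fintype_prod (f := fun i (x : ℝ) => x ^ a i)
      fun i => integrable_pow_gaussianReal v (a i)).const_mul c
  | add p q hp hq =>
    refine (hp.add hq).congr (Filter.Eventually.of_forall fun x => ?_)
    simp

theorem integrable_mul_eval_pi_gaussianReal (v : ℝ≥0) (p : MvPolynomial ι ℝ) (i : ι) :
    Integrable (fun x => x i * MvPolynomial.eval x p)
      (Measure.pi fun _ : ι => gaussianReal 0 v) := by
  refine (integrable_eval_pi_gaussianReal v (MvPolynomial.X i * p)).congr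
    (Filter.Eventually.of_forall fun x => ?_)
  simp

/-- Gaussian integration by parts for polynomials. -/
theorem integral_mul_eval_pi_gaussianReal (v : ℝ≥0) (p : MvPolynomial ι ℝ) (i : ι) :
    ∫ x, x i * MvPolynomial.eval x p ∂(Measure.pi fun _ : ι => gaussianReal 0 v) =
      v * ∫ x, MvPolynomial.eval x (MvPolynomial.pderiv i p)
        ∂(Measure.pi fun _ : ι => gaussianReal 0 v) := by
  classical
  induction p using MvPolynomial.induction_on' with
  | monomial a c =>
    rw [MvPolynomial.pderiv_monomial]
    simp only [MvPolynomial.eval_monomial, Finsupp.prod_fintype _ _ (fun i => pow_zero _)]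
    have h1 : ∀ x : ι → ℝ, x i * (c * ∏ j, x j ^ a j) =
        c * ∏ j, x j ^ (a j + if j = i then 1 else 0) := by
      intro x
      simp only [pow_add, Finset.prod_mul_distrib, pow_ite, pow_one, pow_zero,
        Finset.prod_ite_eq', Finset.mem_univ, if_true]
      ring
    simp only [h1]
    rw [integral_const_mul, integral_const_mul,
      integral_fintype_prod_eq_prod (fun j (y : ℝ) => y ^ (a j + if j = i then 1 else 0)),
      integral_fintype_prod_eq_prod (fun j (y : ℝ) => y ^ ((a - Finsupp.single i 1 : ι →₀ ℕ) j)),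
      Fintype.prod_eq_mul_prod_compl i, Fintype.prod_eq_mul_prod_compl i]
    have h2 : ∀ j ∈ ({i}ᶜ : Finset ι), ∫ y, y ^ (a j + if j = i then 1 else 0) ∂gaussianReal 0 v =
        ∫ y, y ^ ((a - Finsupp.single i 1 : ι →₀ ℕ) j) ∂gaussianReal 0 v := by
      intro j hj
      have hj' : j ≠ i := by simpa using hj
      simp [hj']
    rw [Finset.prod_congr rfl h2]
    have h3 := integral_pow_succ_gaussianReal v (a i)
    simp only [if_true, h3]
    simp
    ring
  | add p q hp hq =>
    simp only [map_add, mul_add]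
    rw [integral_add (integrable_mul_eval_pi_gaussianReal v p i)
      (integrable_mul_eval_pi_gaussianReal v q i),
      integral_add (integrable_eval_pi_gaussianReal v _)
      (integrable_eval_pi_gaussianReal v _), hp, hq, mul_add]

end GaussianMoments

/-! ### Matrices of polynomials and Gaussian matrix series -/

section MatrixPolynomials

variable {ι N : Type*} [Fintype N]

theorem map_pderiv_mul (i : ι) (M M' : Matrix N N (MvPolynomial ι ℝ)) :
    (M * M').map (MvPolynomial.pderiv i) =
      M.map (MvPolynomial.pderiv i) * M' + M * M'.map (MvPolynomial.pderiv i) := by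
  ext j k : 1
  simp only [Matrix.map_apply, Matrix.mul_apply, Matrix.add_apply, map_sum, Derivation.leibniz,
    smul_eq_mul]
  rw [← Finset.sum_add_distrib]
  exact Finset.sum_congr rfl fun l _ => by ring

variable [DecidableEq N]

/-- The noncommutative Leibniz rule: the derivative hits each of the m + 1 factors in turn. -/
theorem map_pderiv_pow (i : ι) (M : Matrix N N (MvPolynomial ι ℝ)) (m : ℕ) :
    (M ^ (m + 1)).map (MvPolynomial.pderiv i) =
      ∑ q ∈ Finset.range (m + 1), M ^ q * M.map (MvPolynomial.pderiv i) * M ^ (m - q) := by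
  induction m with
  | zero => simp
  | succ m ih =>
    rw [pow_succ, map_pderiv_mul, ih]
    generalize M.map (MvPolynomial.pderiv i) = D
    have h : ∀ q ∈ Finset.range (m + 1),
        M ^ q * D * M ^ (m - q) * M = M ^ q * D * M ^ (m + 1 - q) := fun q hq => by
      have : q ≤ m := Nat.lt_succ_iff.mp (Finset.mem_range.mp hq)
      rw [Matrix.mul_assoc, ← pow_succ, Nat.sub_add_comm this]
    rw [Finset.sum_range_succ _ (m + 1), Finset.sum_mul, Finset.sum_congr rfl h, Nat.sub_self,
      pow_zero, Matrix.mul_one]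

theorem eval_trace (M : Matrix N N (MvPolynomial ι ℝ)) (x : ι → ℝ) :
    MvPolynomial.eval x M.trace = ((MvPolynomial.eval x).mapMatrix M).trace := by
  simp [Matrix.trace]

theorem mapMatrix_eval_map_C (A : Matrix N N ℝ) (x : ι → ℝ) :
    (MvPolynomial.eval x).mapMatrix (A.map MvPolynomial.C) = A := by
  ext j k
  simp

end MatrixPolynomials

section MatrixSeries

variable {ι N : Type*} [Fintype ι]

/-- The matrix series `∑ i, x i • A i`. -/
def matSeries (A : ι → Matrix N N ℝ) (x : ι → ℝ) : Matrix N N ℝ := ∑ i, x i • A i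

/-- The matrix series `∑ i, X i • A i` with polynomial entries. -/
noncomputable def polySeries (A : ι → Matrix N N ℝ) : Matrix N N (MvPolynomial ι ℝ) :=
  ∑ i, (MvPolynomial.X i : MvPolynomial ι ℝ) • (A i).map MvPolynomial.C

theorem map_pderiv_polySeries (A : ι → Matrix N N ℝ) (i : ι) :
    (polySeries A).map (MvPolynomial.pderiv i) = (A i).map MvPolynomial.C := by
  classical
  ext j k : 1
  simp [polySeries, Matrix.sum_apply, MvPolynomial.pderiv_X, Pi.single_apply]

variable [Fintype N] [DecidableEq N]

theorem mapMatrix_eval_polySeries (A : ι → Matrix N N ℝ) (x : ι → ℝ) :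
    (MvPolynomial.eval x).mapMatrix (polySeries A) = matSeries A x := by
  ext j k
  simp [polySeries, matSeries, Matrix.sum_apply]

theorem integrable_trace_matSeries_pow (v : ℝ≥0) (A : ι → Matrix N N ℝ) (m : ℕ) :
    Integrable (fun x => (matSeries A x ^ m).trace)
      (Measure.pi fun _ : ι => gaussianReal 0 v) := by
  refine (integrable_eval_pi_gaussianReal v (polySeries A ^ m).trace).congr
    (Filter.Eventually.of_forall fun x => ?_)
  simp only [eval_trace, map_pow, mapMatrix_eval_polySeries]

/-- One factor of the series is expanded as ∑ x_i A_i and each x_i is integrated by parts against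
the remaining power, viewed as a polynomial in x. -/
theorem integral_trace_matSeries_pow (v : ℝ≥0) (A : ι → Matrix N N ℝ) (m : ℕ) :
    ∫ x, (matSeries A x ^ (m + 2)).trace ∂(Measure.pi fun _ : ι => gaussianReal 0 v) =
      v * ∑ i, ∑ q ∈ Finset.range (m + 1),
        ∫ x, (A i * matSeries A x ^ q * A i * matSeries A x ^ (m - q)).trace
          ∂(Measure.pi fun _ : ι => gaussianReal 0 v) := by
  have h1 : ∀ x, (matSeries A x ^ (m + 2)).trace = ∑ i, x i * MvPolynomial.eval x
      ((A i).map MvPolynomial.C * polySeries A ^ (m + 1)).trace := by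
    intro x
    simp only [eval_trace, map_mul, map_pow, mapMatrix_eval_polySeries, mapMatrix_eval_map_C]
    rw [pow_succ']
    nth_rewrite 1 [matSeries]
    simp [Finset.sum_mul, Matrix.trace_sum, Matrix.trace_smul]
  simp only [h1]
  rw [integral_finsetSum _ (fun i _ => integrable_mul_eval_pi_gaussianReal v _ i), Finset.mul_sum]
  refine Finset.sum_congr rfl fun i _ => ?_
  rw [integral_mul_eval_pi_gaussianReal]
  congr 1
  have h2 : MvPolynomial.pderiv i ((A i).map MvPolynomial.C * polySeries A ^ (m + 1)).trace =
      ∑ q ∈ Finset.range (m + 1), ((A i).map MvPolynomial.C * polySeries A ^ q *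
        (A i).map MvPolynomial.C * polySeries A ^ (m - q)).trace := by
    have h3 : ∀ M : Matrix N N (MvPolynomial ι ℝ),
        MvPolynomial.pderiv i M.trace = (M.map (MvPolynomial.pderiv i)).trace := fun M => by
      simp [Matrix.trace]
    have h4 : ((A i).map MvPolynomial.C : Matrix N N (MvPolynomial ι ℝ)).map
        (MvPolynomial.pderiv i) = 0 := by ext j k : 1; simp
    rw [h3, map_pderiv_mul, h4, Matrix.zero_mul, zero_add, map_pderiv_pow, map_pderiv_polySeries,
      Finset.mul_sum, Matrix.trace_sum]
    simp only [Matrix.mul_assoc]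
  rw [h2]
  simp only [map_sum]
  rw [integral_finsetSum _ (fun q _ => integrable_eval_pi_gaussianReal v _)]
  simp only [eval_trace, map_mul, map_pow, mapMatrix_eval_polySeries, mapMatrix_eval_map_C]

/-- Trace moments of a Gaussian matrix series (noncommutative Khintchine inequality). -/
theorem integral_trace_matSeries_pow_le (v : ℝ≥0) {A : ι → Matrix N N ℝ}
    (hA : ∀ i, (A i).transpose = A i) {b : ℝ} (hb : 0 ≤ b)
    (hAb : ∀ H : Matrix N N ℝ, (∀ j, 0 ≤ H j j) → ∑ i, (A i * A i * H).trace ≤ b * H.trace)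
    {p k : ℕ} (hk : k ≤ p) :
    ∫ x, (matSeries A x ^ (2 * k)).trace ∂(Measure.pi fun _ : ι => gaussianReal 0 v) ≤
      Fintype.card N * (2 * p * v * b) ^ k := by
  have hS : ∀ x, (matSeries A x).transpose = matSeries A x := fun x => by
    simp [matSeries, Matrix.transpose_sum, hA]
  induction k with
  | zero => simp
  | succ k ih =>
    have hint : ∀ i, ∀ q m : ℕ, Integrable
        (fun x => (A i * matSeries A x ^ q * A i * matSeries A x ^ m).trace)
          (Measure.pi fun _ : ι => gaussianReal 0 v) := fun i q m => by
      refine (integrable_eval_pi_gaussianReal v ((A i).map MvPolynomial.C * polySeries A ^ q *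
        (A i).map MvPolynomial.C * polySeries A ^ m).trace).congr
        (Filter.Eventually.of_forall fun x => ?_)
      simp only [eval_trace, map_mul, map_pow, mapMatrix_eval_polySeries, mapMatrix_eval_map_C]
    have hint0 : ∀ i, Integrable
        (fun x => (A i * A i * matSeries A x ^ (2 * k)).trace)
          (Measure.pi fun _ : ι => gaussianReal 0 v) := fun i => by
      simpa using hint i 0 (2 * k)
    -- Integration by parts yields 2k + 1 terms for each i. As the total power 2k is even, each is
    -- at most the term with both copies of A_i adjacent; `hAb` then applies to the 2k-th power of
    -- the series, whose diagonal is nonnegative.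
    have hstep : ∫ x, (matSeries A x ^ (2 * (k + 1))).trace
        ∂(Measure.pi fun _ : ι => gaussianReal 0 v) ≤
        v * ((2 * k + 1) * (b * ∫ x, (matSeries A x ^ (2 * k)).trace
          ∂(Measure.pi fun _ : ι => gaussianReal 0 v))) := by
      rw [show 2 * (k + 1) = 2 * k + 2 by ring, integral_trace_matSeries_pow]
      refine mul_le_mul_of_nonneg_left ?_ v.2
      calc _ ≤ ∑ i, ∑ q ∈ Finset.range (2 * k + 1),
            ∫ x, (A i * A i * matSeries A x ^ (2 * k)).trace
              ∂(Measure.pi fun _ : ι => gaussianReal 0 v) := by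
            refine Finset.sum_le_sum fun i _ => Finset.sum_le_sum fun q hq => ?_
            refine integral_mono (hint i _ _) (hint0 i) fun x => ?_
            have hq' : q + (2 * k - q) = 2 * k := by
              have := Finset.mem_range.mp hq; omega
            have := trace_mul_pow_mul_pow_le (hA i) (hS x) q (2 * k - q)
              (by rw [hq']; exact even_two_mul k)
            rwa [hq'] at this
        _ = (2 * k + 1) * ∫ x, ∑ i, (A i * A i * matSeries A x ^ (2 * k)).trace
              ∂(Measure.pi fun _ : ι => gaussianReal 0 v) := by
            rw [integral_finsetSum _ (fun i _ => hint0 i), Finset.mul_sum]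
            simp
        _ ≤ _ := by
            refine mul_le_mul_of_nonneg_left ?_ (by positivity)
            rw [← integral_const_mul]
            exact integral_mono (integrable_finsetSum _ fun i _ => hint0 i)
              ((integrable_trace_matSeries_pow v A (2 * k)).const_mul b)
              fun x => hAb _ fun j => pow_even_diag_nonneg (hS x) k j
    refine hstep.trans ?_
    have ih' := ih (by omega)
    have hkp : (2 * k + 1 : ℝ) ≤ 2 * p := by
      have : (k + 1 : ℝ) ≤ p := by exact_mod_cast hk
      linarith
    have hv := v.2
    calc _ ≤ (v : ℝ) * ((2 * k + 1) * (b * (Fintype.card N * (2 * p * v * b) ^ k))) := by gcongr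
      _ ≤ (v : ℝ) * ((2 * p) * (b * (Fintype.card N * (2 * p * v * b) ^ k))) := by gcongr
      _ = _ := by rw [pow_succ]; ring

end MatrixSeries

/-! ### Markov's inequality and the tail of the Gaussian spectral norm -/

theorem measure_lt_le_of_integral_le {α : Type*} [MeasurableSpace α] {μ : Measure α}
    [IsFiniteMeasure μ] {f : α → ℝ} (hf : Integrable f μ) (h0 : ∀ x, 0 ≤ f x) {c ε : ℝ}
    (hc : 0 ≤ c) (h : ∫ x, f x ∂μ ≤ ε * c) : μ {x | c < f x} ≤ ENNReal.ofReal ε := by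
  -- For c = 0 the hypothesis forces f = 0 almost everywhere. This case occurs when the noise
  -- variance or all the weights vanish.
  rcases hc.eq_or_lt with rfl | hc
  · have h1 : ∫ x, f x ∂μ = 0 := le_antisymm (by simpa using h) (integral_nonneg h0)
    rw [integral_eq_zero_iff_of_nonneg h0 hf] at h1
    have h2 : μ {x | 0 < f x} = 0 := by
      refine measure_mono_null (fun x hx => ?_) h1
      exact ne_of_gt hx
    rw [h2]; exact zero_le
  · have h1 := mul_meas_ge_le_integral_of_nonneg (Filter.Eventually.of_forall h0) hf c
    have h2 : μ.real {x | c ≤ f x} ≤ ε := by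
      have := h1.trans h
      rw [mul_comm ε] at this
      exact le_of_mul_le_mul_left this hc
    calc μ {x | c < f x} ≤ μ {x | c ≤ f x} := measure_mono fun x (hx : c < f x) => hx.le
      _ = ENNReal.ofReal (μ.real {x | c ≤ f x}) := by
        rw [Measure.real, ENNReal.ofReal_toReal (measure_ne_top _ _)]
      _ ≤ _ := ENNReal.ofReal_le_ofReal h2

theorem trace_fromBlocks {a b : Type*} [Fintype a] [Fintype b] (A : Matrix a a ℝ)
    (B : Matrix a b ℝ) (B' : Matrix b a ℝ) (A' : Matrix b b ℝ) :
    (Matrix.fromBlocks A B B' A').trace = A.trace + A'.trace := by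
  simp [Matrix.trace]

section Tail

/-- The choice of exponent in the moment method. -/
theorem exists_moment_exponent {D : ℝ} (hD : 2 ≤ D) {u : ℝ} (hu : 0 ≤ u) :
    ∃ p : ℕ, p ≠ 0 ∧ D * (2 * p * u) ^ p ≤ 1 / D * (7 * √(u * Real.log D)) ^ (2 * p) := by
  have hL : (1 / 2 : ℝ) ≤ Real.log D := by
    have := Real.log_two_gt_d9
    have := Real.log_le_log (by norm_num) hD
    linarith
  have hD0 : 0 < D := by linarith
  -- With p = ⌈log D⌉ one has D² ≤ e^(2p), which absorbs the dimension and the factor 1/D. Since log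
  -- D ≥ 1/2, also p ≤ 3 log D, and e² · 2p ≤ 8 · 6 log D ≤ 7² log D explains the constant 7.
  refine ⟨⌈Real.log D⌉₊, ?_, ?_⟩
  · exact (Nat.ceil_pos.mpr (by linarith)).ne'
  · set p := ⌈Real.log D⌉₊
    have h1 : Real.log D ≤ p := Nat.le_ceil _
    have h2 : (p : ℝ) ≤ 3 * Real.log D := by
      have := Nat.ceil_lt_add_one (a := Real.log D) (by linarith)
      change (p : ℝ) < _ at this
      linarith
    have h3 : D ^ 2 ≤ (Real.exp 1 ^ 2) ^ p := by
      rw [← pow_mul, mul_comm 2 p, pow_mul]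
      refine pow_le_pow_left₀ hD0.le ?_ 2
      rw [← Real.exp_nat_mul, mul_one, ← Real.log_le_iff_le_exp hD0]
      exact h1
    have he : Real.exp 1 ^ 2 ≤ 8 := by
      have := Real.exp_one_lt_d9
      have := Real.exp_pos 1
      nlinarith
    have h4 : Real.exp 1 ^ 2 * (2 * p * u) ≤ 49 * (u * Real.log D) := by
      calc Real.exp 1 ^ 2 * (2 * p * u) ≤ 8 * (2 * (3 * Real.log D) * u) := by gcongr
        _ ≤ _ := by nlinarith [mul_nonneg hu (by linarith : 0 ≤ Real.log D)]
    have h5 : (7 * √(u * Real.log D)) ^ (2 * p) = (49 * (u * Real.log D)) ^ p := by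
      rw [pow_mul, mul_pow, Real.sq_sqrt (mul_nonneg hu (by linarith))]; norm_num
    rw [h5, one_div, ← div_eq_inv_mul, le_div_iff₀ hD0]
    calc D * (2 * p * u) ^ p * D = D ^ 2 * (2 * p * u) ^ p := by ring
      _ ≤ (Real.exp 1 ^ 2) ^ p * (2 * p * u) ^ p := by gcongr
      _ = (Real.exp 1 ^ 2 * (2 * p * u)) ^ p := (mul_pow _ _ p).symm
      _ ≤ _ := by gcongr

variable {a b : Type} [DecidableEq a] [DecidableEq b]

/-- The coefficients of the Hermitian dilation of the matrix with independent entries of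
standard deviations `β i j`. -/
def dilationCoeff (β : Matrix a b ℝ) (q : a × b) : Matrix (a ⊕ b) (a ⊕ b) ℝ :=
  Matrix.fromBlocks 0 (Matrix.single q.1 q.2 (β q.1 q.2)) (Matrix.single q.2 q.1 (β q.1 q.2)) 0

theorem dilationCoeff_transpose (β : Matrix a b ℝ) (q : a × b) :
    (dilationCoeff β q).transpose = dilationCoeff β q := by
  simp [dilationCoeff, Matrix.fromBlocks_transpose]

variable [Fintype a] [Fintype b]

theorem matSeries_dilationCoeff (β : Matrix a b ℝ) (x : a × b → ℝ) :
    matSeries (dilationCoeff β) x =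
      Matrix.fromBlocks 0 (Matrix.of fun i j => β i j * x (i, j))
        (Matrix.of fun i j => β i j * x (i, j)).transpose 0 := by
  ext i j
  rcases i with i | i <;> rcases j with j | j <;>
    simp [matSeries, dilationCoeff, Matrix.sum_apply, Matrix.single_apply, Fintype.sum_prod_type,
      ite_and, mul_comm]

/-- The square of each coefficient is diagonal, with β_ij² at the two positions i and j; summation
produces row and column sums of squares. Hence only the diagonal of H matters. -/
theorem sum_trace_dilationCoeff_le {β : Matrix a b ℝ} {c : ℝ} (hr : ∀ i, ∑ j, β i j ^ 2 ≤ c)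
    (hc : ∀ j, ∑ i, β i j ^ 2 ≤ c) (H : Matrix (a ⊕ b) (a ⊕ b) ℝ) (hH : ∀ j, 0 ≤ H j j) :
    ∑ q, (dilationCoeff β q * dilationCoeff β q * H).trace ≤ c * H.trace := by
  have h : ∀ q : a × b, (dilationCoeff β q * dilationCoeff β q * H).trace =
      β q.1 q.2 ^ 2 * H (Sum.inl q.1) (Sum.inl q.1) +
        β q.1 q.2 ^ 2 * H (Sum.inr q.2) (Sum.inr q.2) := by
    intro q
    simp only [dilationCoeff, Matrix.fromBlocks_multiply, Matrix.single_mul_single_same,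
      Matrix.zero_mul, Matrix.mul_zero, zero_add, add_zero]
    rw [← Matrix.fromBlocks_toBlocks H, Matrix.fromBlocks_multiply, trace_fromBlocks]
    simp [Matrix.trace_single_mul, sq, Matrix.toBlocks₁₁, Matrix.toBlocks₂₂]
  simp only [h]
  rw [Finset.sum_add_distrib, Fintype.sum_prod_type, Fintype.sum_prod_type_right, Matrix.trace,
    Fintype.sum_sum_type, mul_add, Finset.mul_sum, Finset.mul_sum]
  refine add_le_add (Finset.sum_le_sum fun i _ => ?_) (Finset.sum_le_sum fun j _ => ?_)
  · dsimp only
    rw [← Finset.sum_mul]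
    exact mul_le_mul_of_nonneg_right (hr i) (hH _)
  · dsimp only
    rw [← Finset.sum_mul]
    exact mul_le_mul_of_nonneg_right (hc j) (hH _)

/-- The spectral norm of a matrix with independent centred Gaussian entries. -/
theorem measure_specNorm_gaussian_le (v : ℝ≥0) {β : Matrix a b ℝ} {c : ℝ} (hc0 : 0 ≤ c)
    (hr : ∀ i, ∑ j, β i j ^ 2 ≤ c) (hc : ∀ j, ∑ i, β i j ^ 2 ≤ c) {D : ℝ} (hD : 2 ≤ D)
    (hcard : (Fintype.card a + Fintype.card b : ℝ) = D) :
    (Measure.pi fun _ : a × b => gaussianReal 0 v)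
      {x | 7 * √(v * c * Real.log D) < specNorm (Matrix.of fun i j => β i j * x (i, j))} ≤
        ENNReal.ofReal (1 / D) := by
  have hu : 0 ≤ v * c := mul_nonneg v.2 hc0
  obtain ⟨p, hp, hpD⟩ := exists_moment_exponent hD hu
  set t := 7 * √(v * c * Real.log D) with ht
  have ht0 : 0 ≤ t := by positivity
  set A := dilationCoeff β
  have hA := dilationCoeff_transpose β
  have hS : ∀ x, (matSeries A x).transpose = matSeries A x := fun x => by
    simp [matSeries, Matrix.transpose_sum, A, hA]
  have hmom := integral_trace_matSeries_pow_le v hA hc0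
    (fun H hH => sum_trace_dilationCoeff_le hr hc H hH) (le_refl p)
  rw [Fintype.card_sum, Nat.cast_add, hcard, mul_assoc _ _ c] at hmom
  refine (measure_mono ?_).trans (measure_lt_le_of_integral_le
    (integrable_trace_matSeries_pow v A (2 * p))
    (fun x => Finset.sum_nonneg fun i _ => pow_even_diag_nonneg (hS x) p i)
    (pow_nonneg ht0 (2 * p)) (hmom.trans hpD))
  intro x hx
  by_contra hcon
  have h1 := specNorm_le_of_trace_pow_le (hS x) ht0 hp (not_lt.mp hcon)
  rw [matSeries_dilationCoeff] at h1
  exact absurd ((specNorm_le_dilation _).trans h1) (not_le.mpr hx)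

end Tail

/-! ### The weighted noise tensor -/

section Noise

variable {n : ℕ} {d : Fin n → ℕ}

/-- The standard deviations `W^(-1/2) ∘ 1_Ω` of the weighted noise, up to the factor `σ`. -/
noncomputable def noiseWeight (W : Tensor d) (Ω : Finset (Index d)) : Tensor d :=
  hadamard (hpow W (-1 / 2)) (indicator Ω)

theorem noiseWeight_sq {W : Tensor d} (hW : ∀ i, 0 < W i) (Ω : Finset (Index d)) (i : Index d) :
    noiseWeight W Ω i ^ 2 = indicator Ω i / W i := by
  have h : (W i ^ (-1 / 2 : ℝ)) ^ 2 = (W i)⁻¹ := by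
    rw [← Real.rpow_natCast, ← Real.rpow_mul (hW i).le]
    norm_num [Real.rpow_neg_one]
  simp only [noiseWeight, hadamard, hpow, mul_pow, h, indicator]
  split_ifs <;> simp

theorem le_muSq (W : Tensor d) (Ω : Finset (Index d)) (k : Fin n) (i : Index d) :
    max (∑ j : Index d with j k = i k, indicator Ω j / W j)
      (∑ a : Fin (d k), indicator Ω (Function.update i k a) / W (Function.update i k a)) ≤
        muSq W Ω k :=
  le_ciSup (f := fun i : Index d => max (∑ j : Index d with j k = i k, indicator Ω j / W j)
      (∑ a : Fin (d k), indicator Ω (Function.update i k a) / W (Function.update i k a)))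
    (Set.finite_range _).bddAbove i

theorem sum_row_noiseWeight_sq_le [Nonempty (Index d)] {W : Tensor d} (hW : ∀ i, 0 < W i)
    (Ω : Finset (Index d)) (k : Fin n) (a : Fin (d k)) :
    ∑ b, unfold (noiseWeight W Ω) k a b ^ 2 ≤ muSq W Ω k := by
  set e := Equiv.piSplitAt k (fun j => Fin (d j)) with he
  -- The row sum depends only on the k-th index, so the other coordinates may be arbitrary.
  set i := e.symm (a, (e (Classical.arbitrary _)).2) with hi
  refine le_trans (le_of_eq ?_) ((le_max_left _ _).trans (le_muSq W Ω k i))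
  have hik : i k = a := piSplitAt_symm_self _ _ _
  rw [hik, Finset.sum_filter, ← e.symm.sum_comp, Fintype.sum_prod_type, Finset.sum_eq_single a]
  · refine Finset.sum_congr rfl fun b _ => ?_
    rw [if_pos (piSplitAt_symm_self _ _ _), ← noiseWeight_sq hW]
    rfl
  · intro a' _ ha'
    refine Finset.sum_eq_zero fun b _ => if_neg ?_
    rw [piSplitAt_symm_self]; exact ha'
  · simp

theorem sum_col_noiseWeight_sq_le [Nonempty (Index d)] {W : Tensor d} (hW : ∀ i, 0 < W i)
    (Ω : Finset (Index d)) (k : Fin n) (b : CoIndex d k) :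
    ∑ a, unfold (noiseWeight W Ω) k a b ^ 2 ≤ muSq W Ω k := by
  set e := Equiv.piSplitAt k (fun j => Fin (d j)) with he
  set i := e.symm (Classical.arbitrary (Index d) k, b) with hi
  refine le_trans (le_of_eq ?_) ((le_max_right _ _).trans (le_muSq W Ω k i))
  refine Finset.sum_congr rfl fun a _ => ?_
  rw [hi, he, update_piSplitAt_symm, ← noiseWeight_sq hW]
  rfl

theorem muSq_nonneg {W : Tensor d} (hW : ∀ i, 0 < W i) (Ω : Finset (Index d)) (k : Fin n) :
    0 ≤ muSq W Ω k := by
  refine Real.iSup_nonneg fun i => le_max_of_le_right (Finset.sum_nonneg fun a _ => ?_)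
  rw [← noiseWeight_sq hW]
  exact sq_nonneg _

theorem dimSum_eq_card (d : Fin n → ℕ) (k : Fin n) :
    (Fintype.card (Fin (d k)) + Fintype.card (CoIndex d k) : ℝ) = dimSum d k := by
  rw [dimSum, Fintype.card_fin, Fintype.card_pi, Nat.cast_prod]
  congr 1
  rw [Finset.prod_subtype (p := fun j => j ≠ k) (F := inferInstance)
    (Finset.univ.erase k) (by simp)]
  simp

theorem two_le_dimSum [Nonempty (Index d)] (k : Fin n) : 2 ≤ dimSum d k := by
  have h : ∀ j, 1 ≤ d j := fun j => (Classical.arbitrary (Index d) j).pos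
  have h1 : (1 : ℝ) ≤ d k := by exact_mod_cast h k
  have h2 : (1 : ℝ) ≤ ∏ j ∈ Finset.univ.erase k, (d j : ℝ) :=
    Finset.one_le_prod fun j _ => by exact_mod_cast h j
  rw [dimSum]; linarith

theorem measure_specNorm_noise_le [Nonempty (Index d)] {W : Tensor d} (hW : ∀ i, 0 < W i)
    (Ω : Finset (Index d)) (k : Fin n) (σ : ℝ≥0) {S : Type*} [MeasurableSpace S] {P : Measure S}
    {Z : Index d → S → ℝ} (hZ : ∀ i, HasLaw (Z i) (gaussianReal 0 (σ ^ 2)) P)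
    (hind : iIndepFun Z P) :
    P {s | 7 * (σ * mu W Ω k * √(Real.log (dimSum d k))) <
        specNorm (unfold (hadamard (noiseWeight W Ω) fun i => Z i s) k)} ≤
      ENNReal.ofReal (1 / dimSum d k) := by
  set e := Equiv.piSplitAt k (fun j => Fin (d j)) with he
  have hm : ∀ q, AEMeasurable (Z (e.symm q)) P := fun q => (hZ _).aemeasurable
  have hmap := (hind.precomp e.symm.injective).map_fun_eq_pi_map hm
  have hlaw : ∀ q, P.map (Z (e.symm q)) = gaussianReal 0 (σ ^ 2) := fun q => (hZ _).map_eq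
  simp only [hlaw] at hmap
  have htail := measure_specNorm_gaussian_le (σ ^ 2) (muSq_nonneg hW Ω k)
    (sum_row_noiseWeight_sq_le hW Ω k) (sum_col_noiseWeight_sq_le hW Ω k) (two_le_dimSum k)
    (dimSum_eq_card d k)
  rw [← hmap] at htail
  -- The inequality `Measure.le_map_apply` holds for arbitrary sets, so the event need not be shown
  -- measurable.
  refine le_trans (le_trans (measure_mono ?_) (Measure.le_map_apply (by fun_prop) _)) htail
  intro s hs
  have ht : √(((σ ^ 2 : ℝ≥0) : ℝ) * muSq W Ω k * Real.log (dimSum d k)) =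
      σ * mu W Ω k * √(Real.log (dimSum d k)) := by
    have h0 := muSq_nonneg hW Ω k
    rw [Real.sqrt_mul (by positivity), Real.sqrt_mul (by positivity), NNReal.coe_pow,
      Real.sqrt_sq σ.coe_nonneg, mu]
  rw [Set.mem_preimage, Set.mem_ofPred_eq, ht]
  exact hs

end Noise

/-! ### Error decomposition and assembly -/

section Main

variable {n : ℕ} {d : Fin n → ℕ}

/-- The difference is the negative of M ⊙ T plus weighted noise; the Schur multiplier bound handles
the first summand, with the unfolding of T as multiplier. -/
theorem specNorm_unfold_sub_weightedData_le [Nonempty (Index d)] (W : Tensor d)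
    (Ω : Finset (Index d)) (T Z : Tensor d) (k : Fin n) :
    specNorm (unfold (hadamard (hpow W (1 / 2)) T - weightedData W Ω T Z) k) ≤
      √(unfold T k).rank * supNorm T * specNorm (unfold (hadamard (hpow W (-1 / 2)) (indicator Ω) -
        hpow W (1 / 2)) k) + specNorm (unfold (hadamard (noiseWeight W Ω) Z) k) := by
  set M := hadamard (hpow W (-1 / 2)) (indicator Ω) - hpow W (1 / 2) with hM
  have h1 : unfold (hadamard (hpow W (1 / 2)) T - weightedData W Ω T Z) k =
      0 - ((Matrix.of fun a b => unfold M k a b * unfold T k a b) +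
        unfold (hadamard (noiseWeight W Ω) Z) k) := by
    ext a b
    simp only [unfold, hM, weightedData, noiseWeight, hadamard, restrict, indicator,
      Matrix.of_apply,
      Pi.sub_apply, Pi.add_apply, Matrix.sub_apply, Matrix.add_apply, Matrix.zero_apply]
    split_ifs <;> ring
  rw [h1, specNorm_sub_comm, sub_zero]
  have : Nonempty (Fin (d k)) := ⟨Classical.arbitrary (Index d) k⟩
  exact (specNorm_add_le _ _).trans (add_le_add_left (specNorm_hadamard_le _ _ (supNorm_nonneg T)
    fun a b => abs_le_supNorm T _) _)

theorem hadamard_sub_wHOSVD {W : Tensor d} (hW : ∀ i, 0 < W i) (Ω : Finset (Index d))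
    (T Z : Tensor d) {r : Fin n → ℕ} (U : ∀ k : Fin n, Matrix (Fin (d k)) (Fin (r k)) ℝ) :
    hadamard (hpow W (1 / 2)) (T - wHOSVD W Ω T Z U) = hadamard (hpow W (1 / 2)) T -
      multiModeProd (weightedData W Ω T Z) fun k => U k * (U k).transpose := by
  ext i
  have h : W i ^ (1 / 2 : ℝ) * W i ^ (-1 / 2 : ℝ) = 1 := by
    rw [← Real.rpow_add (hW i)]; norm_num
  simp only [hadamard, hpow, wHOSVD, Pi.sub_apply]
  rw [mul_sub, ← mul_assoc, h, one_mul]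

end Main

end TensorCompletion

open TensorCompletion in
theorem theorem2 :
    ∃ C : ℝ, 0 < C ∧
      ∀ (n : ℕ), 1 ≤ n → ∀ (d : Fin n → ℕ)
        (w : ∀ k : Fin n, Fin (d k) → ℝ), (∀ i : Index d, 0 < outer w i) →
      ∀ (Ω : Finset (Index d)) (T : Tensor d) (r : Fin n → ℕ), HasTuckerRank T r →
      ∀ (σ : ℝ≥0) (S : Type*) [MeasurableSpace S] (P : Measure S) [IsProbabilityMeasure P]
        (Z : Index d → S → ℝ),
        (∀ i, HasLaw (Z i) (gaussianReal 0 (σ ^ 2)) P) → iIndepFun Z P →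
      ∃ E : Set S, MeasurableSet E ∧
        1 - ∑ k : Fin n, 1 / dimSum d k ≤ P.real E ∧
        ∀ s ∈ E, ∀ U : ∀ k : Fin n, Matrix (Fin (d k)) (Fin (r k)) ℝ,
          IsHOSVDFactors (weightedData (outer w) Ω T (fun i => Z i s)) r U →
          frobNorm (hadamard (hpow (outer w) (1 / 2))
              (T - wHOSVD (outer w) Ω T (fun i => Z i s) U)) ≤
            C * ((∑ k : Fin n, Real.sqrt (r k * Real.log (dimSum d k)) * mu (outer w) Ω k) * σ +
              (∑ k : Fin n, (r k : ℝ) *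
                specNorm (unfold (hadamard (hpow (outer w) (-1 / 2)) (indicator Ω) -
                  hpow (outer w) (1 / 2)) k)) * supNorm T) := by
  -- The constant is 3 from the deterministic bound times 7 from the Gaussian tail.
  refine ⟨21, by norm_num, fun n hn d w hw Ω T r hr σ S _ P _ Z hZ hind => ?_⟩
  -- If some dimension is zero, all norms vanish and the whole space serves as the event; otherwise
  -- every `dimSum d k` is at least 2, as the tail bound requires.
  rcases isEmpty_or_nonempty (Index d) with hempty | hne
  · refine ⟨Set.univ, MeasurableSet.univ, ?_, fun s _ U _ => ?_⟩
    · have h : ∀ k, 0 ≤ 1 / dimSum d k := fun k => by unfold dimSum; positivity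
      have := Finset.sum_nonneg fun k (_ : k ∈ Finset.univ) => h k
      simpa using this
    · have h1 : ∀ X : Tensor d, frobNorm X = 0 := fun X => by simp [frobNorm]
      rw [h1]
      have h2 := supNorm_nonneg T
      have h3 : 0 ≤ ∑ k : Fin n, (r k : ℝ) *
          specNorm (unfold (hadamard (hpow (outer w) (-1 / 2)) (indicator Ω) -
            hpow (outer w) (1 / 2)) k) :=
        Finset.sum_nonneg fun k _ => mul_nonneg (Nat.cast_nonneg _) (specNorm_nonneg _)
      have h4 : 0 ≤ ∑ k : Fin n, √(r k * Real.log (dimSum d k)) * mu (outer w) Ω k :=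
        Finset.sum_nonneg fun k _ => mul_nonneg (Real.sqrt_nonneg _) (Real.sqrt_nonneg _)
      positivity
  set bad : Fin n → Set S := fun k =>
    {s | 7 * (σ * mu (outer w) Ω k * √(Real.log (dimSum d k))) <
      specNorm (unfold (hadamard (noiseWeight (outer w) Ω) fun i => Z i s) k)} with hbad
  -- Union bound. The measurable hull has the same measure as the union, and its complement is the
  -- required measurable event.
  have hprob : P.real (toMeasurable P (⋃ k, bad k)) ≤ ∑ k, 1 / dimSum d k := by
    have hnn : ∀ k ∈ Finset.univ, 0 ≤ 1 / dimSum d k := fun k _ => by unfold dimSum; positivity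
    rw [Measure.real, measure_toMeasurable]
    refine ENNReal.toReal_le_of_le_ofReal (Finset.sum_nonneg hnn) ?_
    rw [ENNReal.ofReal_sum_of_nonneg hnn]
    exact (measure_iUnion_fintype_le P bad).trans
      (Finset.sum_le_sum fun k _ => measure_specNorm_noise_le hw Ω k σ hZ hind)
  refine ⟨(toMeasurable P (⋃ k, bad k))ᶜ, (measurableSet_toMeasurable _ _).compl, ?_,
    fun s hs U hU => ?_⟩
  · rw [probReal_compl_eq_one_sub (measurableSet_toMeasurable _ _)]
    linarith
  have hgood : ∀ k, specNorm (unfold (hadamard (noiseWeight (outer w) Ω) fun i => Z i s) k) ≤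
      7 * (σ * mu (outer w) Ω k * √(Real.log (dimSum d k))) := by
    intro k
    by_contra! h
    exact hs (subset_toMeasurable _ _ (Set.mem_iUnion.mpr ⟨k, h⟩))
  rw [hadamard_sub_wHOSVD hw]
  refine (frobNorm_sub_hosvd_le hn (fun k => (rank_unfold_hadamard_hpow_le hw (1 / 2) T k).trans
    (hr k).le) hU).trans ?_
  rw [show (21 : ℝ) = 3 * 7 by norm_num, mul_assoc]
  refine mul_le_mul_of_nonneg_left ?_ (by norm_num)
  rw [Finset.sum_mul, Finset.sum_mul, ← Finset.sum_add_distrib, Finset.mul_sum]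
  refine Finset.sum_le_sum fun k _ => ?_
  have h1 := (specNorm_unfold_sub_weightedData_le _ Ω T (fun i => Z i s) k).trans
    (add_le_add_right (hgood k) _)
  rw [hr k] at h1
  refine (mul_le_mul_of_nonneg_left h1 (Real.sqrt_nonneg (r k))).trans ?_
  set m := specNorm (unfold (hadamard (hpow (outer w) (-1 / 2)) (indicator Ω) -
    hpow (outer w) (1 / 2)) k)
  have h2 : √(r k : ℝ) * √(r k : ℝ) = r k := Real.mul_self_sqrt (Nat.cast_nonneg _)
  have h3 : 0 ≤ r k * m * supNorm T :=
    mul_nonneg (mul_nonneg (Nat.cast_nonneg _) (specNorm_nonneg _)) (supNorm_nonneg T)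
  rw [Real.sqrt_mul (Nat.cast_nonneg _)]
  calc _ = (√(r k : ℝ) * √(r k : ℝ)) * m * supNorm T +
        7 * (√(r k) * √(Real.log (dimSum d k)) * mu (outer w) Ω k * σ) := by ring
    _ ≤ _ := by rw [h2]; linarith
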